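/- **Conventions.** $\mathbf C\{z_1\}$ is the ring of convergent power series. The Newton polygon $N(P)$ of $P=\sum a_{ij}z_1^iz_2^j\in\mathbf C\{z_1\}[z_2]$ is the convex hull in $\mathbf R^2$ of $\bigcup_{a_{ij}\ne0}\big((j,i)+\mathbf N^2\big)$; the exponent of $z_2$ is on the horizontal axis and the exponent of $z_1$ on the vertical axis. More generally a Newton polygon is the convex hull of $\bigcup_{A\in S}(A+\mathbf N^2)$ for a nonempty $S\subset\mathbf N^2$; it has finite area if its complement in the positive quadrant has finite area. The sum of two Newton polygons is the convex hull of the set of sums $p_1+p_2$ of their points. For positive integers $\ell,h$ the elementary polygon $E(\ell,h)$ of length $\ell$ and height $h$ is the convex hull of $\big((\ell,0)+\mathbf N^2\big)\cup\big((0,h)+\mathbf N^2\big)$. Every Newton polygon of finite area is a finite sum of elementary polygons (the empty sum being the positive quadrant). Put $$E(\ell,h)*E(\ell',h')=E\big(\ell\ell',\min(\ell h',\ell'h)\big),\qquad \Big(\sum_iE_i\Big)*\Big(\sum_jE'_j\Big)=\sum_{i,j}E_i*E'_j ;$$ this does not depend on the decompositions. For a compact edge $\gamma$ of $N(P)$ let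 $P_\gamma$ be the sum of the terms of $P$ whose exponents lie on $\gamma$. **Proposition.** Let $N_1,N_2$ be Newton polygons of finite area. (1) Let $P_1,P_2\in\mathbf C\{z_1\}[z_2]$ be monic in $z_2$ with $N(P_i)=N_i$ $(i=1,2)$, such that $P_1(0,z_2)$ and $P_2(0,z_2)$ have no common zero other than $z_2=0$ (which holds automatically if one of the $P_i$ is a Weierstrass polynomial, i.e. $P_i(0,z_2)$ is a power of $z_2$). Suppose that for every compact edge $\gamma_1$ of $N_1$ and every compact edge $\gamma_2$ of $N_2$ the polynomials $P_{1,\gamma_1}$ and $P_{2,\gamma_2}$ have no common zero $(z_1,z_2)$ with $z_1z_2\neq0$ in some neighbourhood of the origin. Then $$N\big(\mathrm{Res}_U(P_1(z_2+U),P_2(U))\big)=N_1*N_2 .$$ (2) The condition on the edge polynomials in (1) is a non-empty Zariski-open condition on the coefficients on the edges: there is a nonzero polynomial $F$ over $\mathbf C$, whose variables are indexed by the disjoint union of the sets of lattice points on the compact edges of $N_1$ and of $N_2$, such that for all $P_1,P_2\in\mathbf C\{z_1\}[z_2]$ with $N(P_i)=N_i$ the condition holds if and only if $F$ does not vanish at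 the corresponding coefficients of $P_1,P_2$. -/

import Mathlib

open scoped Polynomial Topology

namespace NewtonProduct

/-! ### The ring of convergent power series in one variable -/

/-- A formal power series over `ℂ` converges near `0` if it converges absolutely on a disk of
positive radius. -/
def IsConvergent (f : PowerSeries ℂ) : Prop :=
  ∃ r : ℝ, 0 < r ∧ Summable fun n : ℕ => ‖PowerSeries.coeff n f * (r : ℂ) ^ n‖

theorem isConvergent_polynomial (p : ℂ[X]) : IsConvergent (p : PowerSeries ℂ) := by
  refine ⟨1, one_pos, summable_of_ne_finset_zero (s := p.support) fun n hn => ?_⟩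
  simp [Polynomial.notMem_support_iff.mp hn]

theorem IsConvergent.mono {f : PowerSeries ℂ} {r s : ℝ} (hs : 0 < s) (hsr : s ≤ r)
    (h : Summable fun n : ℕ => ‖PowerSeries.coeff n f * (r : ℂ) ^ n‖) :
    Summable fun n : ℕ => ‖PowerSeries.coeff n f * (s : ℂ) ^ n‖ := by
  refine Summable.of_nonneg_of_le (fun n => norm_nonneg _) (fun n => ?_) h
  rw [norm_mul, norm_mul, norm_pow, norm_pow, Complex.norm_real, Complex.norm_real,
    Real.norm_of_nonneg hs.le, Real.norm_of_nonneg (hs.le.trans hsr)]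
  gcongr

/-- The ring `ℂ{z₁}` of convergent power series, as a subring of `ℂ⟦z₁⟧`. -/
def convergentSeries : Subring (PowerSeries ℂ) where
  carrier := {f | IsConvergent f}
  zero_mem' := by simpa using isConvergent_polynomial 0
  one_mem' := by simpa using isConvergent_polynomial 1
  add_mem' := by
    rintro f g ⟨r, hr, hf⟩ ⟨s, hs, hg⟩
    have hf' := IsConvergent.mono (lt_min hr hs) (min_le_left r s) hf
    have hg' := IsConvergent.mono (lt_min hr hs) (min_le_right r s) hg
    refine ⟨min r s, lt_min hr hs, Summable.of_nonneg_of_le (fun n => norm_nonneg _)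
      (fun n => ?_) (hf'.add hg')⟩
    rw [map_add, add_mul]
    exact norm_add_le _ _
  neg_mem' := by
    rintro f ⟨r, hr, hf⟩
    exact ⟨r, hr, by simpa using hf⟩
  mul_mem' := by
    rintro f g ⟨r, hr, hf⟩ ⟨s, hs, hg⟩
    have hf' := IsConvergent.mono (lt_min hr hs) (min_le_left r s) hf
    have hg' := IsConvergent.mono (lt_min hr hs) (min_le_right r s) hg
    refine ⟨min r s, lt_min hr hs,
      (summable_norm_sum_mul_antidiagonal_of_summable_norm hf' hg').congr fun n => ?_⟩
    rw [PowerSeries.coeff_mul, Finset.sum_mul]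
    congr 1
    refine Finset.sum_congr rfl fun k hk => ?_
    rw [← Finset.HasAntidiagonal.mem_antidiagonal.mp hk, pow_add]
    ring

/-- `ℂ{z₁}`. -/
abbrev Cz : Type := convergentSeries

/-- The coefficient of `z₁ ^ i * z₂ ^ j` in an element `P` of `ℂ{z₁}[z₂]`. -/
noncomputable def coeffAt (P : Cz[X]) (j i : ℕ) : ℂ :=
  PowerSeries.coeff i (P.coeff j : PowerSeries ℂ)

/-- The polynomial `P(0, z₂)`. -/
noncomputable def atZero (P : Cz[X]) : ℂ[X] :=
  P.map ((PowerSeries.constantCoeff (R := ℂ)).comp convergentSeries.subtype)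

/-! ### Newton polygons

Newton polygons are drawn in `ℝ × ℝ`; the first coordinate is horizontal, the second vertical.
They are represented by the convex region that they bound. -/

/-- A lattice point, seen in the plane. -/
def toPlane (a : ℕ × ℕ) : ℝ × ℝ := (a.1, a.2)

/-- The convex hull of `⋃ (a + ℕ²)` for `a ∈ S`. -/
def hullOf (S : Set (ℕ × ℕ)) : Set (ℝ × ℝ) :=
  convexHull ℝ {p | ∃ a ∈ S, ∃ b : ℕ × ℕ, p = toPlane (a + b)}

/-- Newton polygons: the sets that arise from supports of nonzero power series. -/
def IsNewtonPolygon (N : Set (ℝ × ℝ)) : Prop :=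
  ∃ S : Set (ℕ × ℕ), S.Nonempty ∧ N = hullOf S

/-- The complement of the polygon in the positive quadrant has finite area. -/
def HasFiniteArea (N : Set (ℝ × ℝ)) : Prop :=
  MeasureTheory.volume ({p : ℝ × ℝ | 0 ≤ p.1 ∧ 0 ≤ p.2} \ N) < ⊤

/-- The Newton polygon of `P ∈ ℂ{z₁}[z₂]`, with the exponent of `z₂` on the horizontal axis and
the exponent of `z₁` on the vertical axis: the monomial `z₁ ^ i * z₂ ^ j` sits at `(j, i)`. -/
def newtonPolygon (P : Cz[X]) : Set (ℝ × ℝ) :=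
  hullOf {a | coeffAt P a.1 a.2 ≠ 0}

/-- The elementary polygon of length `l` (on the horizontal axis) and height `h`. -/
def elementary (l h : ℕ) : Set (ℝ × ℝ) := hullOf {(l, 0), (0, h)}

/-- The sum of two Newton polygons. -/
def polygonAdd (M N : Set (ℝ × ℝ)) : Set (ℝ × ℝ) :=
  convexHull ℝ {p | ∃ x ∈ M, ∃ y ∈ N, p = x + y}

/-- The sum of the elementary polygons with the (length, height) pairs listed in `D`. The empty
sum is the positive quadrant, which is the neutral element of the addition of polygons. -/
def elementarySum (D : List (ℕ × ℕ)) : Set (ℝ × ℝ) :=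
  D.foldr (fun d N => polygonAdd (elementary d.1 d.2) N) (hullOf {(0, 0)})

/-- `D` lists the lengths and heights in a decomposition of `N` as a sum of elementary polygons. -/
def IsDecomposition (N : Set (ℝ × ℝ)) (D : List (ℕ × ℕ)) : Prop :=
  (∀ d ∈ D, 0 < d.1 ∧ 0 < d.2) ∧ N = elementarySum D

open Classical in
/-- A decomposition of `N` as a sum of elementary polygons; every Newton polygon of finite area
has one. -/
noncomputable def decomposition (N : Set (ℝ × ℝ)) : List (ℕ × ℕ) :=
  if h : ∃ D, IsDecomposition N D then h.choose else []

/-- The (length, height) pair of the product of two elementary polygons. -/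
def elementaryMul (d e : ℕ × ℕ) : ℕ × ℕ := (d.1 * e.1, min (d.1 * e.2) (e.1 * d.2))

/-- The product `M * N` of two Newton polygons of finite area: the sum of the products
`Mᵢ * Nⱼ` for decompositions `M = ∑ Mᵢ`, `N = ∑ Nⱼ` into elementary polygons. The result does not
depend on the decompositions. -/
noncomputable def polygonMul (M N : Set (ℝ × ℝ)) : Set (ℝ × ℝ) :=
  elementarySum
    ((decomposition M ×ˢ decomposition N).map fun de => elementaryMul de.1 de.2)

/-! ### Compact edges and edge polynomials -/

/-- `γ` is a compact edge of `N`: the face on which a linear form with positive coefficients is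
minimal, when this face is not a single point. -/
def IsCompactEdge (N γ : Set (ℝ × ℝ)) : Prop :=
  γ.Nontrivial ∧ ∃ u v : ℝ, 0 < u ∧ 0 < v ∧
    γ = {p ∈ N | ∀ q ∈ N, u * p.1 + v * p.2 ≤ u * q.1 + v * q.2}

/-- The sum of the terms of `P` whose exponents lie on `γ`, as an element of `ℂ[z₁][z₂]`. -/
noncomputable def edgePolynomial (P : Cz[X]) (γ : Set (ℝ × ℝ)) : ℂ[X][X] :=
  ∑ᶠ a ∈ {a : ℕ × ℕ | toPlane a ∈ γ},
    Polynomial.monomial a.1 (Polynomial.monomial a.2 (coeffAt P a.1 a.2))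

/-- For every compact edge `γ₁` of `N₁` and `γ₂` of `N₂`, the edge polynomials of `P₁` and `P₂`
have no common zero off the coordinate axes in some neighbourhood of the origin. -/
def EdgesInGeneralPosition (N₁ N₂ : Set (ℝ × ℝ)) (P₁ P₂ : Cz[X]) : Prop :=
  ∀ γ₁ γ₂ : Set (ℝ × ℝ), IsCompactEdge N₁ γ₁ → IsCompactEdge N₂ γ₂ →
    ∀ᶠ z : ℂ × ℂ in 𝓝 0, z.1 ≠ 0 → z.2 ≠ 0 →
      ¬ ((edgePolynomial P₁ γ₁).evalEval z.1 z.2 = 0 ∧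
        (edgePolynomial P₂ γ₂).evalEval z.1 z.2 = 0)

/-- The lattice points on the compact edges of `N`. -/
def EdgePoint (N : Set (ℝ × ℝ)) : Type :=
  {a : ℕ × ℕ // ∃ γ, IsCompactEdge N γ ∧ toPlane a ∈ γ}

/-- The coefficients of `P₁` and `P₂` at the lattice points of the compact edges. -/
noncomputable def edgeCoeffs (N₁ N₂ : Set (ℝ × ℝ)) (P₁ P₂ : Cz[X]) :
    EdgePoint N₁ ⊕ EdgePoint N₂ → ℂ :=
  Sum.elim (fun a => coeffAt P₁ a.1.1 a.1.2) (fun a => coeffAt P₂ a.1.1 a.1.2)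

/-! ### The resultant -/

/-- `Res_U (P₁(T + U), P₂(U))`, an element of `V[T]`; the outer variable of `V[T][U]` is `U`. -/
noncomputable def resultantPoly {V : Type*} [CommRing V] (P₁ P₂ : V[X]) : V[X] :=
  Polynomial.resultant
    ((P₁.map Polynomial.C).comp (Polynomial.C Polynomial.X + Polynomial.X))
    (P₂.map Polynomial.C)

end NewtonProduct

/-!
Embed `ℂ⟦z₁⟧` in an algebraically closed field with an absolute value extending the `z₁`-adic one.
The Gauss norm of radius `r` of a monic polynomial `P = ∏ (X - α)` is multiplicative, hence equal
to `∏ max(r, |α|)`. In logarithmic terms, the support function of `N(P)` at `(t, 1)` is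
`∑ min(t, ord α)`, so that `N(P)` encodes the multiset of the orders of the roots of `P`.

The roots of `Res_U(P₁(z₂ + U), P₂(U))` are the differences `α - β` of a root of `P₁` and a root of
`P₂`. If `ord α ≠ ord β`, then `ord (α - β) = min(ord α, ord β)`. If `ord α = ord β = q / p`, a
larger order of `α - β` would make the common residue of `α / z₁ ^ (q / p)` and
`β / z₁ ^ (q / p)` a common zero of the two initial forms of slope `q / p`. For `q > 0` these are
edge polynomials at `z₁ = 1`, and for `q = 0` they are `P₁(0, z₂)` and `P₂(0, z₂)`. Hence in general
position the orders of the roots are the `min(ord α, ord β)`, which is the rule for `N₁ * N₂`.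

For the second part, `log |z₂| - t log |z₁|` is bounded on the zeros of the edge polynomial of slope
`t`, so that two edges of different slopes have no common zero near the origin. For edges of equal
slope, quasi-homogeneity reduces the condition to `z₁ = 1`, where it says that the resultant of two
polynomials in one variable does not vanish.
-/

namespace NewtonProduct

open scoped Pointwise

/-! ### Support functions of Newton polygons -/

/-- The linear form `t * x + y` on the plane. Its minima over a Newton polygon, as `t` ranges over
the positive reals, determine the polygon. -/
noncomputable def weight (t : ℝ) : (ℝ × ℝ) →ₗ[ℝ] ℝ :=
  t • LinearMap.fst ℝ ℝ ℝ + LinearMap.snd ℝ ℝ ℝ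

@[simp]
theorem weight_apply (t : ℝ) (p : ℝ × ℝ) : weight t p = t * p.1 + p.2 := by
  simp [weight]

@[simp]
theorem toPlane_add (a b : ℕ × ℕ) : toPlane (a + b) = toPlane a + toPlane b := by
  simp [toPlane]

theorem weight_toPlane_nonneg {t : ℝ} (ht : 0 ≤ t) (a : ℕ × ℕ) : 0 ≤ weight t (toPlane a) := by
  rw [weight_apply, toPlane]
  positivity

theorem toPlane_mem_hullOf {S : Set (ℕ × ℕ)} {a : ℕ × ℕ} (ha : a ∈ S) : toPlane a ∈ hullOf S :=
  subset_convexHull ℝ _ ⟨a, ha, 0, by simp⟩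

theorem toPlane_add_mem_hullOf {S : Set (ℕ × ℕ)} {a : ℕ × ℕ} (ha : a ∈ S) (b : ℕ × ℕ) :
    toPlane (a + b) ∈ hullOf S :=
  subset_convexHull ℝ _ ⟨a, ha, b, rfl⟩

theorem hullOf_eq_convexHull (S : Set (ℕ × ℕ)) :
    hullOf S = convexHull ℝ (toPlane '' S + Set.range toPlane) := by
  unfold hullOf
  congr 1
  ext p
  simp only [Set.mem_ofPred_eq, Set.mem_add, Set.exists_mem_image, Set.exists_range_iff,
    toPlane_add, eq_comm]

theorem convexHull_range_natCast : convexHull ℝ (Set.range ((↑) : ℕ → ℝ)) = Set.Ici 0 := by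
  refine subset_antisymm (convexHull_min ?_ (convex_Ici 0)) fun x hx => ?_
  · rintro _ ⟨n, rfl⟩
    exact Nat.cast_nonneg (α := ℝ) n
  · obtain ⟨n, hn⟩ := exists_nat_ge x
    refine segment_subset_convexHull (𝕜 := ℝ) (Set.mem_range.2 ⟨0, Nat.cast_zero⟩)
      (Set.mem_range_self n) ?_
    rw [segment_eq_Icc (Nat.cast_nonneg n)]
    exact ⟨hx, hn⟩

theorem convexHull_range_toPlane :
    convexHull ℝ (Set.range toPlane) = Set.Ici (0 : ℝ) ×ˢ Set.Ici (0 : ℝ) := by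
  have : Set.range toPlane = Set.range ((↑) : ℕ → ℝ) ×ˢ Set.range ((↑) : ℕ → ℝ) := by
    ext ⟨x, y⟩
    simp [toPlane]
  rw [this, convexHull_prod, convexHull_range_natCast]

theorem hullOf_eq_add (S : Set (ℕ × ℕ)) :
    hullOf S = convexHull ℝ (toPlane '' S) + Set.Ici (0 : ℝ) ×ˢ Set.Ici (0 : ℝ) := by
  rw [hullOf_eq_convexHull, convexHull_add, convexHull_range_toPlane]

theorem hullOf_eq_of_subset_of_forall_exists_le {S T : Set (ℕ × ℕ)} (hTS : T ⊆ S)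
    (h : ∀ a ∈ S, ∃ b ∈ T, b ≤ a) : hullOf T = hullOf S := by
  unfold hullOf
  congr 1
  ext p
  constructor
  · rintro ⟨a, ha, b, rfl⟩
    exact ⟨a, hTS ha, b, rfl⟩
  · rintro ⟨a, ha, b, rfl⟩
    obtain ⟨c, hc, hca⟩ := h a ha
    exact ⟨c, hc, (a - c) + b, by rw [← add_assoc, add_tsub_cancel_of_le hca]⟩

/- Dickson's lemma: a subset of `ℕ²` has finitely many minimal elements. -/
theorem exists_finite_hullOf_eq (S : Set (ℕ × ℕ)) :
    ∃ T : Set (ℕ × ℕ), T.Finite ∧ hullOf T = hullOf S := by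
  refine ⟨{a | Minimal (· ∈ S) a}, ?_, ?_⟩
  · exact WellQuasiOrderedLE.finite_of_isAntichain (setOfPred_minimal_antichain _)
  · refine hullOf_eq_of_subset_of_forall_exists_le (fun a ha => ha.prop) fun a ha => ?_
    obtain ⟨b, hb, hb'⟩ := exists_minimal_le_of_wellFoundedLT (· ∈ S) a ha
    exact ⟨b, hb', hb⟩

theorem isClosed_hullOf (S : Set (ℕ × ℕ)) : IsClosed (hullOf S) := by
  obtain ⟨T, hT, hTS⟩ := exists_finite_hullOf_eq S
  rw [← hTS, hullOf_eq_add]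
  exact (isClosed_Ici.prod isClosed_Ici).add_left_of_isCompact
    ((hT.image _).isCompact_convexHull ℝ)

theorem le_map_of_mem_hullOf {S : Set (ℕ × ℕ)} {f : (ℝ × ℝ) →ₗ[ℝ] ℝ} {m : ℝ}
    (hf : ∀ b, 0 ≤ f (toPlane b)) (h : ∀ a ∈ S, m ≤ f (toPlane a)) {p : ℝ × ℝ}
    (hp : p ∈ hullOf S) : m ≤ f p := by
  refine convexHull_min (t := {p | m ≤ f p}) ?_ (convex_halfSpace_ge f.isLinear m) hp
  rintro _ ⟨a, ha, b, rfl⟩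
  rw [Set.mem_ofPred_eq, toPlane_add, map_add]
  exact le_add_of_le_of_nonneg (h a ha) (hf b)

theorem le_weight_of_mem_hullOf {S : Set (ℕ × ℕ)} {t m : ℝ} (ht : 0 ≤ t)
    (h : ∀ a ∈ S, m ≤ weight t (toPlane a)) {p : ℝ × ℝ} (hp : p ∈ hullOf S) : m ≤ weight t p :=
  le_map_of_mem_hullOf (weight_toPlane_nonneg ht) h hp

theorem nonneg_of_forall_natCast_lt {c s u : ℝ} (h : ∀ n : ℕ, s < c + u * n) : 0 ≤ u := by
  by_contra! hu
  obtain ⟨n, hn⟩ := exists_nat_gt ((c - s) / -u)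
  rw [div_lt_iff₀ (neg_pos.2 hu)] at hn
  linarith [h n]

theorem exists_separating_of_notMem_hullOf {S : Set (ℕ × ℕ)} (hS : S.Nonempty) {p : ℝ × ℝ}
    (hp : p ∉ hullOf S) : ∃ u v s : ℝ, 0 ≤ u ∧ 0 ≤ v ∧ u * p.1 + v * p.2 < s ∧
      ∀ q ∈ hullOf S, s < u * q.1 + v * q.2 := by
  obtain ⟨f, s, hfp, hf⟩ := geometric_hahn_banach_point_closed (convex_convexHull ℝ _)
    (isClosed_hullOf S) hp
  have hfe (q : ℝ × ℝ) : f q = f (1, 0) * q.1 + f (0, 1) * q.2 := by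
    have : q = q.1 • ((1 : ℝ), (0 : ℝ)) + q.2 • ((0 : ℝ), (1 : ℝ)) := by ext <;> simp
    conv_lhs => rw [this]
    rw [map_add, map_smul, map_smul, smul_eq_mul, smul_eq_mul, mul_comm, mul_comm q.2]
  obtain ⟨a, ha⟩ := hS
  refine ⟨f (1, 0), f (0, 1), s, ?_, ?_, hfe p ▸ hfp, fun q hq => hfe q ▸ hf q hq⟩
  · refine nonneg_of_forall_natCast_lt (c := f (toPlane a)) (s := s) fun n => ?_
    have := hf _ (toPlane_add_mem_hullOf ha (n, 0))
    rw [toPlane_add, map_add, hfe (toPlane (n, 0))] at this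
    simpa [toPlane] using this
  · refine nonneg_of_forall_natCast_lt (c := f (toPlane a)) (s := s) fun n => ?_
    have := hf _ (toPlane_add_mem_hullOf ha (0, n))
    rw [toPlane_add, map_add, hfe (toPlane (0, n))] at this
    simpa [toPlane] using this

theorem exists_weight_lt_of_notMem_hullOf {S : Set (ℕ × ℕ)} (hS : S.Nonempty) {p : ℝ × ℝ}
    (hp : p ∉ hullOf S) : ∃ t : ℝ, 0 < t ∧ ∀ a ∈ S, weight t p < weight t (toPlane a) := by
  obtain ⟨u, v, s, hu, hv, hps, hs⟩ := exists_separating_of_notMem_hullOf hS hp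
  -- a small multiple of `x + y` is added to the separating form to make its coefficients positive
  obtain ⟨ε, hε, hεp⟩ : ∃ ε : ℝ, 0 < ε ∧ ε * |p.1 + p.2| < s - (u * p.1 + v * p.2) := by
    have := sub_pos.2 hps
    refine ⟨(s - (u * p.1 + v * p.2)) / (|p.1 + p.2| + 1), by positivity, ?_⟩
    rw [div_mul_eq_mul_div, div_lt_iff₀ (by positivity)]
    linarith
  have hvε : 0 < v + ε := by positivity
  have weight_eq (q : ℝ × ℝ) : weight ((u + ε) / (v + ε)) q =
      (u * q.1 + v * q.2 + ε * (q.1 + q.2)) / (v + ε) := by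
    rw [weight_apply]
    field_simp
    ring
  refine ⟨(u + ε) / (v + ε), by positivity, fun a ha => ?_⟩
  rw [weight_eq, weight_eq]
  refine div_lt_div_of_pos_right ?_ hvε
  have hp' : ε * (p.1 + p.2) ≤ ε * |p.1 + p.2| := by gcongr; exact le_abs_self _
  have ha' : 0 ≤ ε * ((toPlane a).1 + (toPlane a).2) := by rw [toPlane]; positivity
  linarith [hs _ (toPlane_mem_hullOf ha)]

/-- `f t` is the minimum of `t * x + y` over the points `(x, y)` of `S`, hence over `hullOf S`, for
all `t > 0`. -/
def IsSupportFunction (S : Set (ℕ × ℕ)) (f : ℝ → ℝ) : Prop :=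
  ∀ t, 0 < t → IsLeast ((fun a => weight t (toPlane a)) '' S) (f t)

namespace IsSupportFunction

variable {S T : Set (ℕ × ℕ)} {f g : ℝ → ℝ}

theorem exists_weight_eq (h : IsSupportFunction S f) {t : ℝ} (ht : 0 < t) :
    ∃ a ∈ S, weight t (toPlane a) = f t :=
  (h t ht).1

theorem le_weight (h : IsSupportFunction S f) {t : ℝ} (ht : 0 < t) {a : ℕ × ℕ} (ha : a ∈ S) :
    f t ≤ weight t (toPlane a) :=
  (h t ht).2 ⟨a, ha, rfl⟩

theorem le_weight_of_mem_hullOf (h : IsSupportFunction S f) {t : ℝ} (ht : 0 < t) {p : ℝ × ℝ}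
    (hp : p ∈ hullOf S) : f t ≤ weight t p :=
  NewtonProduct.le_weight_of_mem_hullOf ht.le (fun _ => h.le_weight ht) hp

theorem congr (h : IsSupportFunction S f) (hfg : ∀ t, 0 < t → f t = g t) :
    IsSupportFunction S g :=
  fun t ht => hfg t ht ▸ h t ht

theorem hullOf_subset (hS : IsSupportFunction S f) (hT : IsSupportFunction T f) :
    hullOf S ⊆ hullOf T := by
  intro p hp
  by_contra hpT
  obtain ⟨t, ht, hlt⟩ := exists_weight_lt_of_notMem_hullOf
    ((hT.exists_weight_eq one_pos).imp fun _ => And.left) hpT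
  obtain ⟨a, ha, hat⟩ := hT.exists_weight_eq ht
  exact (hlt a ha).not_ge (hat ▸ hS.le_weight_of_mem_hullOf ht hp)

theorem hullOf_eq (hS : IsSupportFunction S f) (hT : IsSupportFunction T f) :
    hullOf S = hullOf T :=
  (hS.hullOf_subset hT).antisymm (hT.hullOf_subset hS)

theorem eq_of_hullOf_eq (hS : IsSupportFunction S f) (hT : IsSupportFunction T g)
    (h : hullOf S = hullOf T) {t : ℝ} (ht : 0 < t) : f t = g t := by
  obtain ⟨a, ha, hat⟩ := hS.exists_weight_eq ht
  obtain ⟨b, hb, hbt⟩ := hT.exists_weight_eq ht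
  refine le_antisymm ?_ ?_
  · exact hbt ▸ hS.le_weight_of_mem_hullOf ht (h ▸ toPlane_mem_hullOf hb)
  · exact hat ▸ hT.le_weight_of_mem_hullOf ht (h ▸ toPlane_mem_hullOf ha)

theorem add (hS : IsSupportFunction S f) (hT : IsSupportFunction T g) :
    IsSupportFunction (S + T) (f + g) := by
  intro t ht
  obtain ⟨a, ha, hat⟩ := hS.exists_weight_eq ht
  obtain ⟨b, hb, hbt⟩ := hT.exists_weight_eq ht
  refine ⟨⟨a + b, Set.add_mem_add ha hb, ?_⟩, ?_⟩
  · simp only [toPlane_add, map_add, hat, hbt, Pi.add_apply]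
  · rintro _ ⟨_, ⟨c, hc, d, hd, rfl⟩, rfl⟩
    simp only [toPlane_add, map_add]
    exact add_le_add (hS.le_weight ht hc) (hT.le_weight ht hd)

end IsSupportFunction

theorem image_toPlane_add (S T : Set (ℕ × ℕ)) :
    toPlane '' (S + T) = toPlane '' S + toPlane '' T :=
  Set.image_image2_distrib toPlane_add

theorem polygonAdd_hullOf (S T : Set (ℕ × ℕ)) :
    polygonAdd (hullOf S) (hullOf T) = hullOf (S + T) := by
  have sum_eq : {p | ∃ x ∈ hullOf S, ∃ y ∈ hullOf T, p = x + y} = hullOf S + hullOf T := by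
    ext p
    simp only [Set.mem_ofPred_eq, Set.mem_add, eq_comm]
  have range_add_range : Set.range toPlane + Set.range toPlane = Set.range toPlane := by
    rw [← Set.image_univ, ← image_toPlane_add, Set.univ_add_univ]
  rw [polygonAdd, sum_eq, hullOf_eq_convexHull, hullOf_eq_convexHull, hullOf_eq_convexHull,
    ← convexHull_add, (convex_convexHull ℝ _).convexHull_eq, image_toPlane_add,
    add_add_add_comm, range_add_range]

theorem isSupportFunction_pair (l h : ℕ) :
    IsSupportFunction {(l, 0), (0, h)} fun t => min (t * l) h := by
  intro t _
  rw [Set.image_pair]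
  simpa [toPlane] using isLeast_pair (a := t * (l : ℝ)) (b := (h : ℝ))

theorem exists_elementarySum_eq_hullOf (D : List (ℕ × ℕ)) : ∃ S : Set (ℕ × ℕ),
    elementarySum D = hullOf S ∧
      IsSupportFunction S fun t => (D.map fun d => min (t * d.1) (d.2 : ℝ)).sum := by
  induction D with
  | nil => exact ⟨{(0, 0)}, rfl, fun t _ => by simp [toPlane]⟩
  | cons d D ih =>
    obtain ⟨S, hS, h⟩ := ih
    refine ⟨{(d.1, 0), (0, d.2)} + S, ?_, (isSupportFunction_pair d.1 d.2).add h⟩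
    rw [elementarySum, List.foldr_cons, ← elementarySum, hS, elementary, polygonAdd_hullOf]

theorem mem_convexHull_inter_of_forall_le {E : Type*} [AddCommGroup E] [Module ℝ E]
    (f : E →ₗ[ℝ] ℝ) {A : Set E} {m : ℝ} (h : ∀ a ∈ A, m ≤ f a) {p : E}
    (hp : p ∈ convexHull ℝ A) (hpm : f p = m) : p ∈ convexHull ℝ (A ∩ {x | f x = m}) := by
  obtain ⟨ι, _, w, z, hw, hw1, hz, rfl⟩ := mem_convexHull_iff_exists_fintype.1 hp
  have hsum : ∑ i, w i * (f (z i) - m) = 0 := by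
    simp only [map_sum, map_smul, smul_eq_mul] at hpm
    simp [mul_sub, hpm, ← Finset.sum_mul, hw1]
  have hterm := (Finset.sum_eq_zero_iff_of_nonneg fun i _ =>
    mul_nonneg (hw i) (sub_nonneg.2 (h _ (hz i)))).1 hsum
  rw [← finsum_eq_sum_of_fintype]
  refine (convex_convexHull ℝ _).finsum_mem hw (by rwa [finsum_eq_sum_of_fintype]) fun i hi => ?_
  have := (mul_eq_zero.1 (hterm i (Finset.mem_univ i))).resolve_left hi
  exact subset_convexHull ℝ _ ⟨hz i, sub_eq_zero.1 this⟩

theorem exists_zero_fst_mem {S : Set (ℕ × ℕ)} (h : HasFiniteArea (hullOf S)) :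
    ∃ k, (0, k) ∈ S := by
  by_contra! hS
  have one_le : ∀ p ∈ hullOf S, 1 ≤ p.1 := fun p hp => by
    refine le_map_of_mem_hullOf (f := LinearMap.fst ℝ ℝ ℝ) (fun b => by simp [toPlane])
      (fun a ha => ?_) hp
    have : a.1 ≠ 0 := fun h0 => hS a.2 (by rwa [← h0])
    simpa [toPlane] using Nat.one_le_iff_ne_zero.2 this
  have strip_subset : Set.Ico (0 : ℝ) 1 ×ˢ Set.Ici (0 : ℝ) ⊆ {p | 0 ≤ p.1 ∧ 0 ≤ p.2} \ hullOf S :=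
    fun p ⟨⟨hp0, hp1⟩, hp2⟩ => ⟨⟨hp0, hp2⟩, fun hp => (one_le p hp).not_gt hp1⟩
  have strip_top : MeasureTheory.volume (Set.Ico (0 : ℝ) 1 ×ˢ Set.Ici (0 : ℝ)) = ⊤ := by
    rw [MeasureTheory.Measure.volume_eq_prod, MeasureTheory.Measure.prod_prod]
    simp
  exact (strip_top ▸ (MeasureTheory.measure_mono strip_subset).trans_lt h).false

/-! ### Slopes of Newton polygons -/

/-- The function `t ↦ ∑ r ∈ R, min t r`. The support function of a Newton polygon of finite area
has this form, with the slopes of the edges in `R`, counted with the length of the edge. -/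
noncomputable def minSum (R : Multiset ℝ) (t : ℝ) : ℝ :=
  (R.map (min t)).sum

theorem minSum_add (R Q : Multiset ℝ) (t : ℝ) : minSum (R + Q) t = minSum R t + minSum Q t := by
  simp [minSum]

theorem minSum_replicate (n : ℕ) (r t : ℝ) : minSum (Multiset.replicate n r) t = n * min t r := by
  simp [minSum]

theorem minSum_zero_right {R : Multiset ℝ} (hR : ∀ r ∈ R, 0 ≤ r) : minSum R 0 = 0 := by
  refine Multiset.sum_eq_zero fun x hx => ?_
  obtain ⟨r, hr, rfl⟩ := Multiset.mem_map.1 hx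
  exact min_eq_left (hR r hr)

theorem minSum_eq_of_forall_le (p : ℝ → Prop) [DecidablePred p] {R : Multiset ℝ} {t : ℝ}
    (h : ∀ x ∈ R, p x → t ≤ x) (h' : ∀ x ∈ R, ¬ p x → x ≤ t) :
    minSum R t = t * (R.filter p).card + (R.filter fun x => ¬ p x).sum := by
  conv_lhs => rw [← Multiset.filter_add_not p R, minSum_add]
  congr 1
  · rw [minSum, Multiset.map_congr rfl fun x hx =>
      min_eq_left (h x (Multiset.mem_of_mem_filter hx) (Multiset.of_mem_filter hx))]
    simp [mul_comm]
  · rw [minSum, Multiset.map_congr rfl fun x hx =>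
      min_eq_right (h' x (Multiset.mem_of_mem_filter hx)
        (Multiset.of_mem_filter (p := fun x => ¬ p x) hx)),
      Multiset.map_id']

theorem eventually_minSum_eq_right (R : Multiset ℝ) (r : ℝ) :
    ∀ᶠ t in 𝓝[>] r,
      minSum R t = t * (R.filter (r < ·)).card + (R.filter fun x => ¬ r < x).sum := by
  have near (x : ℝ) : ∀ᶠ t in 𝓝[>] r, (r < x → t ≤ x) ∧ (¬ r < x → x ≤ t) := by
    by_cases hx : r < x
    · filter_upwards [mem_nhdsWithin_of_mem_nhds (Iic_mem_nhds hx)] with t ht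
      exact ⟨fun _ => ht, fun h => absurd hx h⟩
    · filter_upwards [self_mem_nhdsWithin] with t ht
      exact ⟨fun h => absurd h hx, fun _ => (not_lt.1 hx).trans ht.le⟩
  filter_upwards [(Filter.eventually_all_finset R.toFinset).2 fun x _ => near x] with t ht
  exact minSum_eq_of_forall_le _ (fun x hx => (ht x (Multiset.mem_toFinset.2 hx)).1)
    fun x hx => (ht x (Multiset.mem_toFinset.2 hx)).2

theorem eventually_minSum_eq_left (R : Multiset ℝ) (r : ℝ) :
    ∀ᶠ t in 𝓝[<] r,
      minSum R t = t * (R.filter (r ≤ ·)).card + (R.filter fun x => ¬ r ≤ x).sum := by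
  have near (x : ℝ) : ∀ᶠ t in 𝓝[<] r, (r ≤ x → t ≤ x) ∧ (¬ r ≤ x → x ≤ t) := by
    by_cases hx : r ≤ x
    · filter_upwards [self_mem_nhdsWithin] with t ht
      exact ⟨fun _ => ht.le.trans hx, fun h => absurd hx h⟩
    · filter_upwards [mem_nhdsWithin_of_mem_nhds (Ici_mem_nhds (not_le.1 hx))] with t ht
      exact ⟨fun h => absurd h hx, fun _ => ht⟩
  filter_upwards [(Filter.eventually_all_finset R.toFinset).2 fun x _ => near x] with t ht
  exact minSum_eq_of_forall_le _ (fun x hx => (ht x (Multiset.mem_toFinset.2 hx)).1)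
    fun x hx => (ht x (Multiset.mem_toFinset.2 hx)).2

theorem minSum_map_min_left (R Q : Multiset ℝ) (t : ℝ) :
    minSum ((R ×ˢ Q).map fun x => min x.1 x.2) t = (R.map fun x => minSum Q (min t x)).sum := by
  change (Multiset.map (min t) ((R.bind fun x => Q.map (Prod.mk x)).map _)).sum = _
  simp [Multiset.map_bind, Multiset.sum_bind, minSum, min_assoc]

theorem minSum_map_min_right (R Q : Multiset ℝ) (t : ℝ) :
    minSum ((R ×ˢ Q).map fun x => min x.1 x.2) t = (Q.map fun y => minSum R (min t y)).sum := by
  rw [minSum_map_min_left]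
  simp only [minSum]
  rw [Multiset.sum_map_sum_map]
  simp only [min_right_comm]

/-- The Newton polygon spanned by `S` has finite area and its edges have the slopes `R`, where the
multiplicity of `r` in `R` is the length of the edge of slope `r`. Zeros in `R` are allowed and do
not affect the polygon. -/
structure HasSlopes (S : Set (ℕ × ℕ)) (R : Multiset ℝ) : Prop where
  nonneg : ∀ r ∈ R, 0 ≤ r
  isSupportFunction : IsSupportFunction S (minSum R)

theorem IsSupportFunction.exists_mem_of_eventuallyEq {S : Set (ℕ × ℕ)} {f : ℝ → ℝ}
    (h : IsSupportFunction S f) {s n c : ℝ} (hs : 0 < s) (hf : f =ᶠ[𝓝 s] fun t => t * n + c) :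
    ∃ a ∈ S, (a.1 : ℝ) = n ∧ (a.2 : ℝ) = c := by
  obtain ⟨a, ha, has⟩ := h.exists_weight_eq hs
  rw [hf.eq_of_nhds, weight_apply] at has
  have hmin : IsLocalMin (fun t => weight t (toPlane a) - (t * n + c)) s := by
    filter_upwards [hf, lt_mem_nhds hs] with t hft ht
    rw [weight_apply s, has, sub_self, ← hft]
    exact sub_nonneg.2 (h.le_weight ht ha)
  have hderiv : HasDerivAt (fun t => weight t (toPlane a) - (t * n + c)) (a.1 - n) s := by
    simpa [toPlane] using (((hasDerivAt_id s).mul_const (a.1 : ℝ)).add_const (a.2 : ℝ)).fun_sub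
      (((hasDerivAt_id s).mul_const n).add_const c)
  have hn : (a.1 : ℝ) = n := sub_eq_zero.1 (hmin.hasDerivAt_eq_zero hderiv)
  refine ⟨a, ha, hn, ?_⟩
  simp only [toPlane, hn] at has
  linarith

namespace HasSlopes

variable {S T : Set (ℕ × ℕ)} {R Q : Multiset ℝ}

theorem exists_vertex_right (h : HasSlopes S R) {r : ℝ} (hr : 0 ≤ r) :
    ∃ a ∈ S, (a.2 : ℝ) = (R.filter fun x => ¬ r < x).sum := by
  obtain ⟨s, hs, hrs⟩ := ((eventually_eventually_nhdsWithin.2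
    (eventually_minSum_eq_right R r)).and self_mem_nhdsWithin).exists
  rw [isOpen_Ioi.nhdsWithin_eq hrs] at hs
  obtain ⟨a, ha, -, ha2⟩ := h.isSupportFunction.exists_mem_of_eventuallyEq (hr.trans_lt hrs) hs
  exact ⟨a, ha, ha2⟩

theorem exists_vertex_left (h : HasSlopes S R) {r : ℝ} (hr : 0 < r) :
    ∃ a ∈ S, (a.2 : ℝ) = (R.filter fun x => ¬ r ≤ x).sum := by
  obtain ⟨s, ⟨hs, hsr⟩, hs0⟩ := (((eventually_eventually_nhdsWithin.2
    (eventually_minSum_eq_left R r)).and self_mem_nhdsWithin).and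
      (mem_nhdsWithin_of_mem_nhds (lt_mem_nhds hr))).exists
  rw [isOpen_Iio.nhdsWithin_eq hsr] at hs
  obtain ⟨a, ha, -, ha2⟩ := h.isSupportFunction.exists_mem_of_eventuallyEq hs0 hs
  exact ⟨a, ha, ha2⟩

/- `k` is the height of the edge of slope `r`. -/
theorem exists_natCast_eq_count_mul (h : HasSlopes S R) {r : ℝ} (hr : 0 ≤ r) :
    ∃ k : ℕ, (k : ℝ) = R.count r * r := by
  obtain rfl | hr := hr.eq_or_lt
  · exact ⟨0, by simp⟩
  obtain ⟨a, -, ha⟩ := h.exists_vertex_right hr.le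
  obtain ⟨b, -, hb⟩ := h.exists_vertex_left hr
  have filter_eq : R.filter (fun x => ¬ r < x) =
      R.filter (fun x => ¬ r ≤ x) + Multiset.replicate (R.count r) r := by
    rw [← Multiset.filter_eq', Multiset.filter_add_filter,
      (Multiset.filter_eq_nil (p := fun x => ¬ r ≤ x ∧ x = r)).2 fun x _ hx => hx.1 hx.2.ge,
      add_zero]
    exact Multiset.filter_congr fun x _ => by rw [not_lt, not_le, le_iff_lt_or_eq]
  have hab : (a.2 : ℝ) = b.2 + R.count r * r := by
    rw [ha, filter_eq, Multiset.sum_add, ← hb, Multiset.sum_replicate, nsmul_eq_mul]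
  have hle : b.2 ≤ a.2 := by
    have : (b.2 : ℝ) ≤ a.2 := hab ▸ le_add_of_nonneg_right (by positivity)
    exact_mod_cast this
  exact ⟨a.2 - b.2, by rw [Nat.cast_sub hle, hab, add_sub_cancel_left]⟩

theorem minSum_eq_of_hullOf_eq (hS : HasSlopes S R) (hT : HasSlopes T Q)
    (h : hullOf S = hullOf T) {t : ℝ} (ht : 0 ≤ t) : minSum R t = minSum Q t := by
  obtain rfl | ht := ht.eq_or_lt
  · rw [minSum_zero_right hS.nonneg, minSum_zero_right hT.nonneg]
  · exact hS.isSupportFunction.eq_of_hullOf_eq hT.isSupportFunction h ht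

theorem minSum_map_min_congr {S' T' : Set (ℕ × ℕ)} {R' Q' : Multiset ℝ}
    (hS : HasSlopes S R) (hS' : HasSlopes S' R') (hSS' : hullOf S = hullOf S')
    (hT : HasSlopes T Q) (hT' : HasSlopes T' Q') (hTT' : hullOf T = hullOf T')
    {t : ℝ} (ht : 0 ≤ t) :
    minSum ((R ×ˢ Q).map fun x => min x.1 x.2) t =
      minSum ((R' ×ˢ Q').map fun x => min x.1 x.2) t := by
  calc minSum ((R ×ˢ Q).map fun x => min x.1 x.2) t
      = (R.map fun x => minSum Q (min t x)).sum := minSum_map_min_left R Q t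
    _ = (R.map fun x => minSum Q' (min t x)).sum := by
      congr 1
      exact Multiset.map_congr rfl fun x hx =>
        hT.minSum_eq_of_hullOf_eq hT' hTT' (le_min ht (hS.nonneg x hx))
    _ = (Q'.map fun y => minSum R (min t y)).sum := by
      rw [← minSum_map_min_left, minSum_map_min_right]
    _ = (Q'.map fun y => minSum R' (min t y)).sum := by
      congr 1
      exact Multiset.map_congr rfl fun y hy =>
        hS.minSum_eq_of_hullOf_eq hS' hSS' (le_min ht (hT'.nonneg y hy))
    _ = minSum ((R' ×ˢ Q').map fun x => min x.1 x.2) t := (minSum_map_min_right R' Q' t).symm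

end HasSlopes

/-- The slopes `h / l` of the elementary polygons with (length, height) pairs `(l, h)` in `D`,
repeated `l` times. -/
noncomputable def slopes (D : List (ℕ × ℕ)) : Multiset ℝ :=
  (D.map fun d => Multiset.replicate d.1 ((d.2 : ℝ) / d.1)).sum

@[simp]
theorem slopes_nil : slopes [] = 0 := rfl

@[simp]
theorem slopes_cons (d : ℕ × ℕ) (D : List (ℕ × ℕ)) :
    slopes (d :: D) = Multiset.replicate d.1 ((d.2 : ℝ) / d.1) + slopes D := by
  simp [slopes]

theorem slopes_append (D E : List (ℕ × ℕ)) : slopes (D ++ E) = slopes D + slopes E := by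
  simp [slopes]

theorem nonneg_of_mem_slopes {D : List (ℕ × ℕ)} {r : ℝ} (hr : r ∈ slopes D) : 0 ≤ r := by
  induction D with
  | nil => simp at hr
  | cons d D ih =>
    rcases Multiset.mem_add.1 (slopes_cons d D ▸ hr) with h | h
    · rw [Multiset.eq_of_mem_replicate h]
      positivity
    · exact ih h

theorem minSum_slopes {D : List (ℕ × ℕ)} (hD : ∀ d ∈ D, 0 < d.1) (t : ℝ) :
    minSum (slopes D) t = (D.map fun d => min (t * d.1) (d.2 : ℝ)).sum := by
  induction D with
  | nil => simp [minSum]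
  | cons d D ih =>
    rw [List.forall_mem_cons] at hD
    have hd : (d.1 : ℝ) ≠ 0 := by exact_mod_cast hD.1.ne'
    rw [slopes_cons, minSum_add, minSum_replicate, ih hD.2, List.map_cons, List.sum_cons,
      mul_min_of_nonneg _ _ d.1.cast_nonneg, mul_div_cancel₀ _ hd, mul_comm t]

theorem exists_elementarySum_eq_hullOf_and_hasSlopes {D : List (ℕ × ℕ)} (hD : ∀ d ∈ D, 0 < d.1) :
    ∃ S, elementarySum D = hullOf S ∧ HasSlopes S (slopes D) := by
  obtain ⟨S, hS, h⟩ := exists_elementarySum_eq_hullOf D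
  exact ⟨S, hS, fun r => nonneg_of_mem_slopes, h.congr fun t _ => (minSum_slopes hD t).symm⟩

theorem slopes_elementaryMul {d e : ℕ × ℕ} (hd : 0 < d.1) (he : 0 < e.1) :
    Multiset.replicate (elementaryMul d e).1
        (((elementaryMul d e).2 : ℝ) / (elementaryMul d e).1) =
      (Multiset.replicate d.1 ((d.2 : ℝ) / d.1) ×ˢ
        Multiset.replicate e.1 ((e.2 : ℝ) / e.1)).map fun x => min x.1 x.2 := by
  refine (Multiset.eq_replicate.2 ⟨by simp [elementaryMul], fun r hr => ?_⟩).symm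
  obtain ⟨⟨x, y⟩, hxy, rfl⟩ := Multiset.mem_map.1 hr
  rw [Multiset.mem_product] at hxy
  obtain rfl := Multiset.eq_of_mem_replicate hxy.1
  obtain rfl := Multiset.eq_of_mem_replicate hxy.2
  have hd' : (0 : ℝ) < d.1 := by exact_mod_cast hd
  have he' : (0 : ℝ) < e.1 := by exact_mod_cast he
  simp only [elementaryMul, Nat.cast_mul, Nat.cast_min]
  rw [← min_div_div_right (by positivity), min_comm, mul_div_mul_left _ _ hd'.ne',
    mul_comm (d.1 : ℝ), mul_div_mul_left _ _ he'.ne']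

theorem slopes_map_elementaryMul {D E : List (ℕ × ℕ)} (hD : ∀ d ∈ D, 0 < d.1)
    (hE : ∀ e ∈ E, 0 < e.1) :
    slopes ((D ×ˢ E).map fun de => elementaryMul de.1 de.2) =
      (slopes D ×ˢ slopes E).map fun x => min x.1 x.2 := by
  have row {d : ℕ × ℕ} (hd : 0 < d.1) : slopes (E.map (elementaryMul d)) =
      (Multiset.replicate d.1 ((d.2 : ℝ) / d.1) ×ˢ slopes E).map fun x => min x.1 x.2 := by
    induction E with
    | nil => simp
    | cons e E ih =>
      rw [List.forall_mem_cons] at hE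
      rw [List.map_cons, slopes_cons, slopes_cons, ih hE.2, slopes_elementaryMul hd hE.1,
        Multiset.product_add, Multiset.map_add]
  induction D with
  | nil => simp
  | cons d D ih =>
    rw [List.forall_mem_cons] at hD
    rw [List.product_cons, List.map_append, slopes_append, ih hD.2, slopes_cons,
      Multiset.add_product, Multiset.map_add, ← row hD.1, List.map_map]
    rfl

/- Each `r > 0` in `R` contributes the elementary polygon of length `R.count r` and slope `r`. -/
theorem HasSlopes.exists_isDecomposition {S : Set (ℕ × ℕ)} {R : Multiset ℝ} (h : HasSlopes S R) :
    ∃ D, IsDecomposition (hullOf S) D := by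
  have hk (r : ℝ) : ∃ k : ℕ, 0 ≤ r → (k : ℝ) = R.count r * r := by
    by_cases hr : 0 ≤ r
    · obtain ⟨k, hk⟩ := h.exists_natCast_eq_count_mul hr
      exact ⟨k, fun _ => hk⟩
    · exact ⟨0, fun h => absurd h hr⟩
  choose k hk using hk
  set F := R.toFinset.filter (0 < ·) with hF
  have pos : ∀ d ∈ F.toList.map fun r => (R.count r, k r), 0 < d.1 ∧ 0 < d.2 := by
    intro d hd
    obtain ⟨r, hr, rfl⟩ := List.mem_map.1 hd
    rw [Finset.mem_toList, hF, Finset.mem_filter, Multiset.mem_toFinset] at hr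
    have hc : 0 < R.count r := Multiset.count_pos.2 hr.1
    have hr0 := hr.2
    have : (0 : ℝ) < k r := by rw [hk r hr0.le]; positivity
    exact ⟨hc, by exact_mod_cast this⟩
  refine ⟨_, pos, ?_⟩
  obtain ⟨T, hT, hT'⟩ := exists_elementarySum_eq_hullOf (F.toList.map fun r => (R.count r, k r))
  rw [hT]
  refine h.isSupportFunction.hullOf_eq (hT'.congr fun t ht => ?_)
  rw [minSum, Finset.sum_multiset_map_count, List.map_map, Finset.sum_map_toList, hF,
    Finset.sum_filter]
  refine Finset.sum_congr rfl fun r hr => ?_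
  have hr0 := h.nonneg r (Multiset.mem_toFinset.1 hr)
  obtain rfl | hr0 := hr0.eq_or_lt
  · simp [ht.le]
  · rw [if_pos hr0, Function.comp_apply, hk r hr0.le, nsmul_eq_mul,
      mul_min_of_nonneg _ _ (Nat.cast_nonneg _), mul_comm t]

theorem isDecomposition_decomposition {N : Set (ℝ × ℝ)} (h : ∃ D, IsDecomposition N D) :
    IsDecomposition N (decomposition N) := by
  rw [decomposition, dif_pos h]
  exact h.choose_spec

theorem hullOf_eq_polygonMul {S T U : Set (ℕ × ℕ)} {R Q : Multiset ℝ} (hS : HasSlopes S R)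
    (hT : HasSlopes T Q) (hU : HasSlopes U ((R ×ˢ Q).map fun x => min x.1 x.2)) :
    hullOf U = polygonMul (hullOf S) (hullOf T) := by
  obtain ⟨hD, hSD⟩ := isDecomposition_decomposition hS.exists_isDecomposition
  obtain ⟨hE, hTE⟩ := isDecomposition_decomposition hT.exists_isDecomposition
  obtain ⟨S', hS', hS's⟩ := exists_elementarySum_eq_hullOf_and_hasSlopes fun d hd => (hD d hd).1
  obtain ⟨T', hT', hT's⟩ := exists_elementarySum_eq_hullOf_and_hasSlopes fun e he => (hE e he).1
  obtain ⟨V, hV, hVs⟩ := exists_elementarySum_eq_hullOf_and_hasSlopes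
    (D := (decomposition (hullOf S) ×ˢ decomposition (hullOf T)).map fun de =>
      elementaryMul de.1 de.2) fun d hd => by
    obtain ⟨⟨d, e⟩, hde, rfl⟩ := List.mem_map.1 hd
    rw [List.mem_product] at hde
    exact Nat.mul_pos (hD d hde.1).1 (hE e hde.2).1
  rw [slopes_map_elementaryMul (fun d hd => (hD d hd).1) fun e he => (hE e he).1] at hVs
  rw [polygonMul, hV]
  exact hU.isSupportFunction.hullOf_eq (hVs.isSupportFunction.congr fun t ht =>
    (hS.minSum_map_min_congr hS's (hSD.trans hS') hT hT's (hTE.trans hT') ht.le).symm)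

/-! ### Gauss norms and slopes -/

/-- `v` is a nonarchimedean absolute value on `L` that restricts along `φ` to the `X`-adic absolute
value with `|X| = ρ`. -/
structure IsAdicExtension {k L : Type*} [Field k] [Field L] (φ : PowerSeries k →+* L)
    (v : AbsoluteValue L ℝ) (ρ : ℝ) : Prop where
  isNonarchimedean : IsNonarchimedean v
  map_le_one : ∀ f, v (φ f) ≤ 1
  map_X : v (φ PowerSeries.X) = ρ
  pos : 0 < ρ
  lt_one : ρ < 1

theorem exists_absoluteValue_algebraicClosure (K : Type*) [NontriviallyNormedField K]
    [IsUltrametricDist K] [CompleteSpace K] : ∃ v : AbsoluteValue (AlgebraicClosure K) ℝ,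
      IsNonarchimedean v ∧ ∀ x : K, v (algebraMap K _ x) = ‖x‖ := by
  let w := spectralMulAlgNorm K (AlgebraicClosure K)
  refine ⟨⟨⟨w, map_mul w⟩, apply_nonneg w, fun x => map_eq_zero_iff_eq_zero w,
    map_add_le_add w⟩, isNonarchimedean_spectralNorm, fun x => spectralNorm_extends x⟩

theorem exists_isAdicExtension.{u} (k : Type u) [Field k] :
    ∃ (L : Type u) (_ : Field L) (_ : IsAlgClosed L) (φ : PowerSeries k →+* L)
      (v : AbsoluteValue L ℝ) (ρ : ℝ), IsAdicExtension φ v ρ := by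
  let V : Valued (LaurentSeries k) (WithZero (Multiplicative ℤ)) := LaurentSeries.valued k
  have hX : V.v ((PowerSeries.X : PowerSeries k) : LaurentSeries k) = WithZero.exp (-1 : ℤ) := by
    simpa using LaurentSeries.valuation_X_pow k 1
  have hX1 : WithZero.exp (-1 : ℤ) < 1 := by
    rw [← WithZero.exp_zero, WithZero.exp_lt_exp]
    norm_num
  have : V.v.IsNontrivial :=
    ⟨_, hX ▸ WithZero.exp_ne_zero, hX ▸ hX1.ne⟩
  have : Function.Surjective V.v := LaurentSeries.valuation_surjective k
  let : V.v.RankOne := Valuation.IsRankOneDiscrete.rankOne V.v (e := 2) (by norm_num)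
  let : NontriviallyNormedField (LaurentSeries k) :=
    Valued.toNontriviallyNormedField (LaurentSeries k) (WithZero (Multiplicative ℤ))
  have : IsUltrametricDist (LaurentSeries k) :=
    Valued.instIsUltrametricDist (LaurentSeries k) (WithZero (Multiplicative ℤ))
  have : CompleteSpace (LaurentSeries k) := LaurentSeries.instLaurentSeriesComplete
  obtain ⟨v, hv, h⟩ := exists_absoluteValue_algebraicClosure (LaurentSeries k)
  refine ⟨AlgebraicClosure (LaurentSeries k), inferInstance, inferInstance,
    (algebraMap (LaurentSeries k) _).comp (HahnSeries.ofPowerSeries ℤ k), v, _, hv, fun f => ?_,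
    rfl, v.pos ?_, ?_⟩
  · rw [RingHom.comp_apply, h]
    exact (Valued.toNormedField.norm_le_one_iff (Γ₀ := WithZero (Multiplicative ℤ))).2
      ((LaurentSeries.val_le_one_iff_eq_coe k _).2 ⟨f, rfl⟩)
  · rw [RingHom.comp_apply, map_ne_zero]
    exact V.v.ne_zero_iff.1 (hX ▸ WithZero.exp_ne_zero)
  · rw [RingHom.comp_apply, h]
    exact (Valued.toNormedField.norm_lt_one_iff (Γ₀ := WithZero (Multiplicative ℤ))).2 (hX ▸ hX1)

/-- The exponents of the monomials of `P`, drawn as in `newtonPolygon`. -/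
def exponents {k : Type*} [Semiring k] (P : (PowerSeries k)[X]) : Set (ℕ × ℕ) :=
  {a | PowerSeries.coeff a.2 (P.coeff a.1) ≠ 0}

theorem newtonPolygon_eq_hullOf_exponents (P : Cz[X]) :
    newtonPolygon P = hullOf (exponents (P.map convergentSeries.subtype)) := by
  simp only [newtonPolygon, exponents, coeffAt, Polynomial.coeff_map, Subring.subtype_apply]

theorem gaussNorm_X_sub_C {L : Type*} [Field L] (v : AbsoluteValue L ℝ) {c : ℝ} (hc : 0 ≤ c)
    (α : L) : (Polynomial.X - Polynomial.C α).gaussNorm v c = max c (v α) := by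
  refine le_antisymm ?_ (max_le ?_ ?_)
  · obtain ⟨i, hi⟩ := (Polynomial.X - Polynomial.C α).exists_eq_gaussNorm v c
    rw [hi]
    match i with
    | 0 => simp
    | 1 => simp
    | i + 2 => simp [Polynomial.coeff_X, hc]
  · refine le_of_eq_of_le ?_ ((Polynomial.X - Polynomial.C α).le_gaussNorm v hc 1)
    simp
  · refine le_of_eq_of_le ?_ ((Polynomial.X - Polynomial.C α).le_gaussNorm v hc 0)
    simp

theorem gaussNorm_multiset_prod {L : Type*} [Field L] {v : AbsoluteValue L ℝ}
    (hv : IsNonarchimedean v) {c : ℝ} (hc : 0 < c) (A : Multiset L[X]) :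
    A.prod.gaussNorm v c = (A.map fun f => f.gaussNorm v c).prod := by
  induction A using Multiset.induction_on with
  | empty => simpa using Polynomial.gaussNorm_C v c (1 : L)
  | cons f A ih =>
    rw [Multiset.prod_cons, Polynomial.gaussNorm_mul hv hc, ih, Multiset.map_cons,
      Multiset.prod_cons]

/-- The order of `α`, normalized so that an element of absolute value `ρ` has order `1`. The order
of `0` is set to `0`. -/
noncomputable def ord {L : Type*} [Field L] (v : AbsoluteValue L ℝ) (ρ : ℝ) (α : L) : ℝ :=
  Real.logb ρ (v α)

namespace IsAdicExtension

variable {k L : Type*} [Field k] [Field L] {φ : PowerSeries k →+* L} {v : AbsoluteValue L ℝ}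
  {ρ : ℝ} {P : (PowerSeries k)[X]} {α : L}

theorem map_eq_one_of_isUnit (H : IsAdicExtension φ v ρ) {f : PowerSeries k} (hf : IsUnit f) :
    v (φ f) = 1 := by
  obtain ⟨g, hg⟩ := hf.exists_right_inv
  have hfg : v (φ f) * v (φ g) = 1 := by rw [← map_mul, ← map_mul, hg, map_one, map_one]
  refine le_antisymm (H.map_le_one f) ?_
  rw [← hfg]
  exact mul_le_of_le_one_right (v.nonneg _) (H.map_le_one g)

theorem map_eq_pow_order (H : IsAdicExtension φ v ρ) {f : PowerSeries k} (hf : f ≠ 0) :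
    v (φ f) = ρ ^ f.order.toNat := by
  have unit : IsUnit f.divXPowOrder := by
    rw [PowerSeries.isUnit_iff_constantCoeff, isUnit_iff_ne_zero, Ne,
      PowerSeries.constantCoeff_divXPowOrder_eq_zero_iff]
    exact hf
  conv_lhs => rw [← PowerSeries.X_pow_order_mul_divXPowOrder (f := f)]
  rw [map_mul, map_mul, map_pow, map_pow, H.map_X, H.map_eq_one_of_isUnit unit, mul_one]

theorem injective (H : IsAdicExtension φ v ρ) : Function.Injective φ := by
  rw [injective_iff_map_eq_zero]
  intro f hf
  by_contra h
  have := H.map_eq_pow_order h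
  rw [hf, map_zero] at this
  exact (pow_pos H.pos _).ne this

theorem map_mul_rpow_pow (H : IsAdicExtension φ v ρ) {f : PowerSeries k} (hf : f ≠ 0) (j : ℕ)
    (t : ℝ) : v (φ f) * (ρ ^ t) ^ j = ρ ^ weight t (toPlane (j, f.order.toNat)) := by
  rw [H.map_eq_pow_order hf, weight_apply, toPlane, Real.rpow_add H.pos, Real.rpow_mul H.pos.le,
    Real.rpow_natCast, Real.rpow_natCast, mul_comm]

theorem isLeast_logb_gaussNorm (H : IsAdicExtension φ v ρ) (hP : P ≠ 0) (t : ℝ) :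
    IsLeast ((fun a => weight t (toPlane a)) '' exponents P)
      (Real.logb ρ ((P.map φ).gaussNorm v (ρ ^ t))) := by
  have hρt : 0 < ρ ^ t := Real.rpow_pos_of_pos H.pos t
  have gauss_ne : (P.map φ).gaussNorm v (ρ ^ t) ≠ 0 := by
    rw [Ne, Polynomial.gaussNorm_eq_zero_iff v _ (fun x => v.eq_zero.1) hρt]
    exact (Polynomial.map_ne_zero_iff H.injective).2 hP
  obtain ⟨j, hj⟩ := (P.map φ).exists_eq_gaussNorm v (ρ ^ t)
  rw [Polynomial.coeff_map] at hj
  have hPj : P.coeff j ≠ 0 := fun h0 => gauss_ne (by rw [hj, h0, map_zero, map_zero, zero_mul])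
  rw [H.map_mul_rpow_pow hPj] at hj
  rw [hj, Real.logb_rpow H.pos H.lt_one.ne]
  refine ⟨⟨(j, (P.coeff j).order.toNat), PowerSeries.coeff_order hPj, rfl⟩, ?_⟩
  rintro _ ⟨⟨j', i⟩, hi, rfl⟩
  have hPj' : P.coeff j' ≠ 0 := fun h0 => hi (by simp [h0])
  have hle := (P.map φ).le_gaussNorm v hρt.le j'
  rw [hj, Polynomial.coeff_map, H.map_mul_rpow_pow hPj',
    Real.rpow_le_rpow_left_iff_of_base_lt_one H.pos H.lt_one] at hle
  have order_le : (((P.coeff j').order.toNat : ℕ) : ℝ) ≤ i := by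
    exact_mod_cast ENat.toNat_le_of_le_natCast (PowerSeries.order_le i hi)
  refine hle.trans ?_
  simp only [weight_apply, toPlane]
  linarith

theorem max_rpow_eq (H : IsAdicExtension φ v ρ) (hα : α ≠ 0) (t : ℝ) :
    max (ρ ^ t) (v α) = ρ ^ min t (ord v ρ α) := by
  have hanti : Antitone fun x : ℝ => ρ ^ x := fun x y h =>
    Real.rpow_le_rpow_of_exponent_ge H.pos H.lt_one.le h
  rw [hanti.map_min, ord, Real.rpow_logb H.pos H.lt_one.ne (v.pos hα)]

theorem rpow_minSum (H : IsAdicExtension φ v ρ) {A : Multiset L} (hA : ∀ α ∈ A, α ≠ 0) (t : ℝ) :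
    ρ ^ minSum (A.map (ord v ρ)) t = (A.map fun α => max (ρ ^ t) (v α)).prod := by
  induction A using Multiset.induction_on with
  | empty => simp [minSum]
  | cons α A ih =>
    rw [Multiset.forall_mem_cons] at hA
    rw [Multiset.map_cons (fun α => max (ρ ^ t) (v α)), Multiset.prod_cons, ← ih hA.2,
      H.max_rpow_eq hA.1, ← Real.rpow_add H.pos]
    simp [minSum]

theorem ord_nonneg (H : IsAdicExtension φ v ρ) (hα : v α ≤ 1) : 0 ≤ ord v ρ α :=
  div_nonneg_of_nonpos (Real.log_nonpos (v.nonneg _) hα) (Real.log_neg H.pos H.lt_one).le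

theorem hasSlopes_of_map_eq_prod (H : IsAdicExtension φ v ρ) {A : Multiset L} {ε : L}
    (hε : v ε = 1) (hA : ∀ α ∈ A, α ≠ 0 ∧ v α ≤ 1)
    (hP : P.map φ = Polynomial.C ε * (A.map fun α => Polynomial.X - Polynomial.C α).prod) :
    HasSlopes (exponents P) (A.map (ord v ρ)) := by
  refine ⟨fun r hr => ?_, fun t _ => ?_⟩
  · obtain ⟨α, hα, rfl⟩ := Multiset.mem_map.1 hr
    exact H.ord_nonneg (hA α hα).2
  have hρt : 0 < ρ ^ t := Real.rpow_pos_of_pos H.pos t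
  have gauss_eq : (P.map φ).gaussNorm v (ρ ^ t) = ρ ^ minSum (A.map (ord v ρ)) t := by
    rw [hP, Polynomial.gaussNorm_mul H.isNonarchimedean hρt, Polynomial.gaussNorm_C, hε, one_mul,
      gaussNorm_multiset_prod H.isNonarchimedean hρt, Multiset.map_map,
      H.rpow_minSum fun α hα => (hA α hα).1]
    simp only [Function.comp_def, gaussNorm_X_sub_C v hρt.le]
  have hP0 : P ≠ 0 := by
    rintro rfl
    rw [Polynomial.map_zero, Polynomial.gaussNorm_zero] at gauss_eq
    exact (Real.rpow_pos_of_pos H.pos _).ne gauss_eq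
  have := H.isLeast_logb_gaussNorm hP0 t
  rwa [gauss_eq, Real.logb_rpow H.pos H.lt_one.ne] at this

theorem root_le_one (H : IsAdicExtension φ v ρ) (hP : P.Monic) (hα : (P.map φ).IsRoot α) :
    v α ≤ 1 := by
  obtain ⟨Q, hQ⟩ := Polynomial.dvd_iff_isRoot.2 hα
  have hQm : Q.Monic := (Polynomial.monic_X_sub_C α).of_mul_monic_left (hQ ▸ hP.map φ)
  have gauss_P : (P.map φ).gaussNorm v 1 ≤ 1 := by
    obtain ⟨j, hj⟩ := (P.map φ).exists_eq_gaussNorm v 1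
    rw [hj, one_pow, mul_one, Polynomial.coeff_map]
    exact H.map_le_one _
  have gauss_Q : 1 ≤ Q.gaussNorm v 1 := by
    simpa [hQm.coeff_natDegree] using Q.le_gaussNorm v zero_le_one Q.natDegree
  rw [hQ, Polynomial.gaussNorm_mul H.isNonarchimedean one_pos, gaussNorm_X_sub_C v zero_le_one]
    at gauss_P
  calc v α ≤ max 1 (v α) := le_max_right _ _
    _ ≤ max 1 (v α) * Q.gaussNorm v 1 := le_mul_of_one_le_right (by positivity) gauss_Q
    _ ≤ 1 := gauss_P

theorem root_ne_zero (H : IsAdicExtension φ v ρ) (h0 : P.coeff 0 ≠ 0)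
    (hα : (P.map φ).IsRoot α) : α ≠ 0 := by
  rintro rfl
  rw [Polynomial.IsRoot, ← Polynomial.coeff_zero_eq_eval_zero, Polynomial.coeff_map,
    map_eq_zero_iff _ H.injective] at hα
  exact h0 hα

theorem map_eq_prod_roots [IsAlgClosed L] (φ : PowerSeries k →+* L) (hP : P.Monic) :
    P.map φ = ((P.map φ).roots.map fun α => Polynomial.X - Polynomial.C α).prod :=
  (IsAlgClosed.splits _).eq_prod_roots_of_monic (hP.map φ)

theorem hasSlopes_roots [IsAlgClosed L] (H : IsAdicExtension φ v ρ) (hP : P.Monic)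
    (h0 : P.coeff 0 ≠ 0) : HasSlopes (exponents P) ((P.map φ).roots.map (ord v ρ)) := by
  refine H.hasSlopes_of_map_eq_prod (ε := 1) (map_one v) (fun α hα => ?_) ?_
  · have hα' := Polynomial.isRoot_of_mem_roots hα
    exact ⟨H.root_ne_zero h0 hα', H.root_le_one hP hα'⟩
  · rw [Polynomial.C_1, one_mul, ← map_eq_prod_roots φ hP]

end IsAdicExtension

/-! ### Slopes of the resultant -/

theorem natDegree_comp_C_X_add_X {V : Type*} [CommRing V] [Nontrivial V] {P : V[X]}
    (hP : P.Monic) :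
    ((P.map Polynomial.C).comp (Polynomial.C Polynomial.X + Polynomial.X) : V[X][X]).natDegree =
      P.natDegree := by
  rw [add_comm, Polynomial.natDegree_comp_eq_of_mul_ne_zero, Polynomial.natDegree_X_add_C, mul_one,
    hP.natDegree_map]
  simp [(hP.map _).leadingCoeff]

theorem map_resultantPoly {V W : Type*} [CommRing V] [CommRing W] [Nontrivial V] [Nontrivial W]
    (f : V →+* W) {P Q : V[X]} (hP : P.Monic) (hQ : Q.Monic) :
    (resultantPoly P Q).map f = resultantPoly (P.map f) (Q.map f) := by
  have hcomp : (Polynomial.mapRingHom f).comp Polynomial.C = Polynomial.C.comp f := by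
    ext; simp
  unfold resultantPoly
  rw [← Polynomial.coe_mapRingHom f, ← Polynomial.resultant_map_map, Polynomial.coe_mapRingHom,
    natDegree_comp_C_X_add_X hP, natDegree_comp_C_X_add_X (hP.map f),
    hQ.natDegree_map Polynomial.C, (hQ.map f).natDegree_map Polynomial.C, hP.natDegree_map,
    hQ.natDegree_map, Polynomial.map_comp, Polynomial.map_map, Polynomial.map_map,
    Polynomial.map_map, Polynomial.map_map, hcomp, Polynomial.map_add, Polynomial.map_C,
    Polynomial.map_X, Polynomial.coe_mapRingHom, Polynomial.map_X]

theorem resultantPoly_prod_X_sub_C {L : Type*} [Field L] (A B : Multiset L) :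
    resultantPoly (A.map fun α => Polynomial.X - Polynomial.C α).prod
        (B.map fun β => Polynomial.X - Polynomial.C β).prod =
      Polynomial.C ((-1) ^ (A.card * B.card)) *
        (((A ×ˢ B).map fun x => x.1 - x.2).map fun γ => Polynomial.X - Polynomial.C γ).prod := by
  have comp_eq : (((A.map fun α => Polynomial.X - Polynomial.C α).prod.map Polynomial.C).comp
      (Polynomial.C Polynomial.X + Polynomial.X) : L[X][X]) =
      ((A.map fun α => Polynomial.C α - Polynomial.X).map
        fun γ => Polynomial.X - Polynomial.C γ).prod := by
    rw [Polynomial.map_multiset_prod, Polynomial.multiset_prod_comp]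
    simp only [Multiset.map_map]
    congr 1
    refine Multiset.map_congr rfl fun α _ => ?_
    simp
    ring
  have eval_eq (α : L) : (((B.map fun β => Polynomial.X - Polynomial.C β).prod).map
      Polynomial.C).eval (Polynomial.C α - Polynomial.X) =
      (-1) ^ B.card * (B.map fun β => Polynomial.X - Polynomial.C (α - β)).prod := by
    rw [Polynomial.map_multiset_prod, Polynomial.eval_multiset_prod, Multiset.map_map,
      Multiset.map_map, ← Multiset.prod_replicate, ← Multiset.map_const', ← Multiset.prod_map_mul]
    congr 1
    refine Multiset.map_congr rfl fun β _ => ?_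
    simp
    ring
  have splits : ((A.map fun α => Polynomial.C α - Polynomial.X).map
      fun γ => Polynomial.X - Polynomial.C γ).prod.Splits := by
    refine Polynomial.Splits.multisetProd fun f hf => ?_
    obtain ⟨γ, -, rfl⟩ := Multiset.mem_map.1 hf
    exact Polynomial.Splits.X_sub_C γ
  unfold resultantPoly
  rw [comp_eq, Polynomial.resultant_eq_prod_eval _ _ _ le_rfl splits,
    Polynomial.roots_multiset_prod_X_sub_C,
    (Polynomial.monic_multisetProd_X_sub_C _).leadingCoeff, one_pow, one_mul, Multiset.map_map]
  simp only [Function.comp_def, eval_eq, Multiset.prod_map_mul, Multiset.map_const',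
    Multiset.prod_replicate]
  rw [← pow_mul, mul_comm B.card, Multiset.map_map]
  congr 1
  · simp
  · exact (Multiset.prod_map_product_eq_prod_prod A B fun x : L × L =>
      (Polynomial.X - Polynomial.C (x.1 - x.2) : L[X])).symm

theorem map_product_map {α β γ δ : Type*} (f : α → γ) (g : β → δ) (s : Multiset α)
    (t : Multiset β) : (s.map f) ×ˢ (t.map g) = (s ×ˢ t).map (Prod.map f g) := by
  induction s using Multiset.induction_on with
  | empty => simp
  | cons a s ih => simp [ih]

namespace IsAdicExtension

variable {k L : Type*} [Field k] [Field L] {φ : PowerSeries k →+* L} {v : AbsoluteValue L ℝ}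
  {ρ : ℝ}

theorem ord_eq_min (H : IsAdicExtension φ v ρ) {α β γ : L} (hα : α ≠ 0) (hβ : β ≠ 0)
    (h : v γ = max (v α) (v β)) : ord v ρ γ = min (ord v ρ α) (ord v ρ β) := by
  have hanti := Real.strictAntiOn_logb_of_base_lt_one H.pos H.lt_one
  rw [ord, h]
  exact hanti.antitoneOn.map_max (v.pos hα) (v.pos hβ)

theorem hasSlopes_resultantPoly [IsAlgClosed L] (H : IsAdicExtension φ v ρ)
    {P Q : (PowerSeries k)[X]} (hP : P.Monic) (hQ : Q.Monic) (hP0 : P.coeff 0 ≠ 0)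
    (hQ0 : Q.coeff 0 ≠ 0)
    (h : ∀ α β, (P.map φ).IsRoot α → (Q.map φ).IsRoot β → v (α - β) = max (v α) (v β)) :
    HasSlopes (exponents (resultantPoly P Q))
      ((((P.map φ).roots.map (ord v ρ)) ×ˢ ((Q.map φ).roots.map (ord v ρ))).map
        fun x => min x.1 x.2) := by
  have roots_spec {x : L × L} (hx : x ∈ (P.map φ).roots ×ˢ (Q.map φ).roots) :
      (x.1 ≠ 0 ∧ v x.1 ≤ 1) ∧ (x.2 ≠ 0 ∧ v x.2 ≤ 1) ∧ v (x.1 - x.2) = max (v x.1) (v x.2) := by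
    obtain ⟨h1, h2⟩ := Multiset.mem_product.1 hx
    have h1' := Polynomial.isRoot_of_mem_roots h1
    have h2' := Polynomial.isRoot_of_mem_roots h2
    exact ⟨⟨H.root_ne_zero hP0 h1', H.root_le_one hP h1'⟩,
      ⟨H.root_ne_zero hQ0 h2', H.root_le_one hQ h2'⟩, h _ _ h1' h2'⟩
  have slopes_eq : ((((P.map φ).roots.map (ord v ρ)) ×ˢ ((Q.map φ).roots.map (ord v ρ))).map
      fun x => min x.1 x.2) =
      (((P.map φ).roots ×ˢ (Q.map φ).roots).map fun x => x.1 - x.2).map (ord v ρ) := by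
    rw [map_product_map, Multiset.map_map, Multiset.map_map]
    refine Multiset.map_congr rfl fun x hx => ?_
    obtain ⟨⟨h1, -⟩, ⟨h2, -⟩, hsub⟩ := roots_spec hx
    exact (H.ord_eq_min h1 h2 hsub).symm
  rw [slopes_eq]
  refine H.hasSlopes_of_map_eq_prod (ε := (-1) ^ ((P.map φ).roots.card * (Q.map φ).roots.card))
    (by simp) (fun γ hγ => ?_) ?_
  · obtain ⟨x, hx, rfl⟩ := Multiset.mem_map.1 hγ
    obtain ⟨⟨h1, h1'⟩, ⟨-, h2'⟩, hsub⟩ := roots_spec hx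
    exact ⟨v.ne_zero_iff.1 (hsub ▸ (lt_max_of_lt_left (v.pos h1)).ne'), hsub ▸ max_le h1' h2'⟩
  · rw [map_resultantPoly _ hP hQ]
    conv_lhs => rw [map_eq_prod_roots φ hP, map_eq_prod_roots φ hQ]
    exact resultantPoly_prod_X_sub_C _ _

end IsAdicExtension

/-! ### Initial forms and their reductions -/

/-- The degree of the monomial `z₁ ^ a.2 * z₂ ^ a.1` when `z₁` has degree `p` and `z₂` has
degree `q`. -/
def level (q p : ℕ) (a : ℕ × ℕ) : ℕ := q * a.1 + p * a.2

section Initial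

variable {k : Type*} [Semiring k]

/-- The order of `P` when `z₁` has degree `p` and `z₂` has degree `q`. -/
noncomputable def minLevel (P : (PowerSeries k)[X]) (q p : ℕ) : ℕ :=
  sInf (level q p '' exponents P)

/-- A finite set of lattice points which, for `0 < p`, contains the exponents of the initial form of
`P` when `z₁` has degree `p` and `z₂` has degree `q`. -/
noncomputable def initialIndex (P : (PowerSeries k)[X]) (q p : ℕ) : Finset (ℕ × ℕ) :=
  {a ∈ P.support ×ˢ Finset.range (minLevel P q p + 1) | level q p a = minLevel P q p}

/-- The initial form of `P` when `z₁` has degree `p` and `z₂` has degree `q`. -/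
noncomputable def initialForm (P : (PowerSeries k)[X]) (q p : ℕ) : (PowerSeries k)[X] :=
  ∑ a ∈ initialIndex P q p,
    Polynomial.monomial a.1 (PowerSeries.C (PowerSeries.coeff a.2 (P.coeff a.1)) *
      PowerSeries.X ^ a.2)

/-- The initial form of `P` at `z₁ = 1`. -/
noncomputable def initialPoly (P : (PowerSeries k)[X]) (q p : ℕ) : k[X] :=
  ∑ a ∈ initialIndex P q p, Polynomial.monomial a.1 (PowerSeries.coeff a.2 (P.coeff a.1))

variable {P : (PowerSeries k)[X]} {q p : ℕ} {a : ℕ × ℕ}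

theorem minLevel_le (ha : a ∈ exponents P) : minLevel P q p ≤ level q p a :=
  Nat.sInf_le ⟨a, ha, rfl⟩

theorem mem_initialIndex (hp : 0 < p) (ha : a ∈ exponents P) (h : level q p a = minLevel P q p) :
    a ∈ initialIndex P q p := by
  simp only [initialIndex, Finset.mem_filter, Finset.mem_product, Polynomial.mem_support_iff,
    Finset.mem_range]
  refine ⟨⟨fun h0 => ha (by rw [h0, map_zero]), ?_⟩, h⟩
  rw [← h, Nat.lt_succ_iff]
  exact (Nat.le_mul_of_pos_left _ hp).trans (Nat.le_add_left _ _)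

theorem coeff_coeff_initialForm (hp : 0 < p) (a : ℕ × ℕ) :
    PowerSeries.coeff a.2 ((initialForm P q p).coeff a.1) =
      if level q p a = minLevel P q p then PowerSeries.coeff a.2 (P.coeff a.1) else 0 := by
  have coeff_eq (b : ℕ × ℕ) : PowerSeries.coeff a.2 ((Polynomial.monomial b.1
      (PowerSeries.C (PowerSeries.coeff b.2 (P.coeff b.1)) * PowerSeries.X ^ b.2)).coeff a.1) =
      if b = a then PowerSeries.coeff a.2 (P.coeff a.1) else 0 := by
    obtain ⟨i, j⟩ := a
    obtain ⟨i', j'⟩ := b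
    simp only [Polynomial.coeff_monomial, Prod.mk.injEq]
    by_cases hi : i' = i
    · simp only [hi, if_true, true_and, PowerSeries.coeff_C_mul_X_pow, eq_comm (a := j)]
      split_ifs with hj
      · rw [hj]
      · rfl
    · simp only [hi, if_false, false_and, map_zero]
  rw [initialForm, Polynomial.finsetSum_coeff, map_sum]
  simp only [coeff_eq, Finset.sum_ite_eq']
  by_cases ha : a ∈ initialIndex P q p
  · rw [if_pos ha, if_pos (Finset.mem_filter.1 ha).2]
  rw [if_neg ha]
  split_ifs with h
  · by_contra h0
    exact ha (mem_initialIndex hp (Ne.symm h0) h)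
  · rfl

end Initial

theorem minLevel_lt_of_mem_exponents_sub {k : Type*} [Ring k] {P : (PowerSeries k)[X]} {q p : ℕ}
    {a : ℕ × ℕ} (hp : 0 < p) (ha : a ∈ exponents (P - initialForm P q p)) :
    minLevel P q p < level q p a := by
  rw [exponents, Set.mem_ofPred_eq, Polynomial.coeff_sub, map_sub, coeff_coeff_initialForm hp] at ha
  split_ifs at ha with h
  · exact absurd (sub_self _) ha
  · rw [sub_zero] at ha
    exact (minLevel_le ha).lt_of_ne' h

theorem eval₂_initialForm {k L : Type*} [CommSemiring k] [CommSemiring L]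
    (φ : PowerSeries k →+* L) (P : (PowerSeries k)[X]) {ζ : L} (ξ : L) {q p : ℕ}
    (hζ : ζ ^ p = φ PowerSeries.X) :
    (initialForm P q p).eval₂ φ (ξ * ζ ^ q) =
      ζ ^ minLevel P q p * (initialPoly P q p).eval₂ (φ.comp PowerSeries.C) ξ := by
  rw [initialForm, initialPoly, Polynomial.eval₂_finsetSum, Polynomial.eval₂_finsetSum,
    Finset.mul_sum]
  refine Finset.sum_congr rfl fun a ha => ?_
  rw [← (Finset.mem_filter.1 ha).2, level, Polynomial.eval₂_monomial, Polynomial.eval₂_monomial,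
    RingHom.comp_apply, pow_add, pow_mul, pow_mul, hζ, mul_pow, map_mul, map_pow]
  ring

theorem exists_add_eq_X_pow {k : Type*} [Field k] [IsAlgClosed k] {f g : k[X]}
    (h : ∀ c, f.IsRoot c → g.IsRoot c → c = 0) :
    ∃ (a b : k[X]) (n : ℕ), f * a + g * b = Polynomial.X ^ n := by
  classical
  set d := EuclideanDomain.gcd f g with hd
  have root_eq_zero (c : k) (hc : d.IsRoot c) : c = 0 :=
    h c (hc.dvd (EuclideanDomain.gcd_dvd_left f g)) (hc.dvd (EuclideanDomain.gcd_dvd_right f g))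
  have hd0 : d ≠ 0 := fun h0 => one_ne_zero (root_eq_zero 1 (by simp [h0]))
  have hdvd : d ∣ Polynomial.X ^ d.roots.card := by
    refine (IsAlgClosed.splits d).dvd_of_roots_le_roots hd0 ?_
    rw [Polynomial.roots_pow, Polynomial.roots_X, Multiset.nsmul_singleton,
      Multiset.eq_replicate_card.2 fun c hc => root_eq_zero c (Polynomial.isRoot_of_mem_roots hc),
      Multiset.card_replicate]
  obtain ⟨e, he⟩ := hdvd
  refine ⟨EuclideanDomain.gcdA f g * e, EuclideanDomain.gcdB f g * e, d.roots.card, ?_⟩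
  rw [he, hd, EuclideanDomain.gcd_eq_gcd_ab]
  ring

namespace IsAdicExtension

variable {k L : Type*} [Field k] [Field L] {φ : PowerSeries k →+* L} {v : AbsoluteValue L ℝ}
  {ρ : ℝ}

theorem map_sum_le (H : IsAdicExtension φ v ρ) {ι : Type*} {s : Finset ι} {f : ι → L} {B : ℝ}
    (hB : 0 ≤ B) (h : ∀ i ∈ s, v (f i) ≤ B) : v (∑ i ∈ s, f i) ≤ B :=
  Finset.sum_induction f (fun x => v x ≤ B)
    (fun a b ha hb => (H.isNonarchimedean a b).trans (max_le ha hb)) (by simpa using hB) h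

theorem lt_one_of_pow_eq (H : IsAdicExtension φ v ρ) {ζ : L} {p : ℕ}
    (hζ : ζ ^ p = φ PowerSeries.X) : v ζ < 1 := by
  by_contra! h
  have := one_le_pow₀ (n := p) h
  rw [← map_pow, hζ, H.map_X] at this
  exact this.not_gt H.lt_one

theorem map_eval₂_le (H : IsAdicExtension φ v ρ) {P : (PowerSeries k)[X]} {ζ ξ : L} {q p n : ℕ}
    (hP : ∀ a ∈ exponents P, n ≤ level q p a) (hζ : ζ ^ p = φ PowerSeries.X) (hξ : v ξ ≤ 1) :
    v (P.eval₂ φ (ξ * ζ ^ q)) ≤ v ζ ^ n := by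
  rw [Polynomial.eval₂_eq_sum, Polynomial.sum]
  refine H.map_sum_le (by positivity) fun j hj => ?_
  have hPj : P.coeff j ≠ 0 := Polynomial.mem_support_iff.1 hj
  have hρ : ρ = v ζ ^ p := by rw [← map_pow, hζ, H.map_X]
  calc v (φ (P.coeff j) * (ξ * ζ ^ q) ^ j)
      = v ξ ^ j * v ζ ^ level q p (j, (P.coeff j).order.toNat) := by
        rw [map_mul, map_pow, map_mul, map_pow, H.map_eq_pow_order hPj, hρ, level, pow_add,
          pow_mul, pow_mul, mul_pow]
        ring
    _ ≤ v ζ ^ level q p (j, (P.coeff j).order.toNat) :=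
        mul_le_of_le_one_left (by positivity) (pow_le_one₀ (v.nonneg _) hξ)
    _ ≤ v ζ ^ n := pow_le_pow_of_le_one (v.nonneg _) (H.lt_one_of_pow_eq hζ).le
        (hP _ (PowerSeries.coeff_order hPj))

theorem eval₂_initialPoly_lt_one (H : IsAdicExtension φ v ρ) {P : (PowerSeries k)[X]} {ζ ξ : L}
    {q p : ℕ} (hp : 0 < p) (hζ : ζ ^ p = φ PowerSeries.X) (hξ : v ξ ≤ 1)
    (hroot : (P.map φ).IsRoot (ξ * ζ ^ q)) :
    v ((initialPoly P q p).eval₂ (φ.comp PowerSeries.C) ξ) < 1 := by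
  have hζ0 : 0 < v ζ := by
    refine v.pos fun h0 => H.pos.ne' ?_
    rw [← H.map_X, ← hζ, h0, zero_pow hp.ne', map_zero]
  have remainder_le :
      v ((P - initialForm P q p).eval₂ φ (ξ * ζ ^ q)) ≤ v ζ ^ (minLevel P q p + 1) :=
    H.map_eval₂_le (fun _ ha => minLevel_lt_of_mem_exponents_sub hp ha) hζ hξ
  rw [Polynomial.IsRoot, Polynomial.eval_map] at hroot
  rw [Polynomial.eval₂_sub, hroot, zero_sub, v.map_neg, eval₂_initialForm φ P ξ hζ, map_mul,
    map_pow, pow_succ] at remainder_le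
  exact (le_of_mul_le_mul_left remainder_le (pow_pos hζ0 _)).trans_lt (H.lt_one_of_pow_eq hζ)

theorem eval₂_le_one (H : IsAdicExtension φ v ρ) (f : k[X]) {ξ : L} (hξ : v ξ ≤ 1) :
    v (f.eval₂ (φ.comp PowerSeries.C) ξ) ≤ 1 := by
  rw [Polynomial.eval₂_eq_sum, Polynomial.sum]
  refine H.map_sum_le zero_le_one fun i _ => ?_
  rw [map_mul, map_pow]
  exact mul_le_one₀ (H.map_le_one _) (by positivity) (pow_le_one₀ (v.nonneg _) hξ)

theorem eval₂_sub_eval₂_le (H : IsAdicExtension φ v ρ) (f : k[X]) {ξ η : L} (hξ : v ξ ≤ 1)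
    (hη : v η ≤ 1) :
    v (f.eval₂ (φ.comp PowerSeries.C) ξ - f.eval₂ (φ.comp PowerSeries.C) η) ≤ v (ξ - η) := by
  rw [Polynomial.eval₂_eq_sum, Polynomial.eval₂_eq_sum, Polynomial.sum, Polynomial.sum,
    ← Finset.sum_sub_distrib]
  refine H.map_sum_le (v.nonneg _) fun i _ => ?_
  rw [← mul_sub, ← (Commute.all ξ η).mul_geom_sum₂, map_mul, map_mul]
  refine (mul_le_of_le_one_left (by positivity) (H.map_le_one _)).trans
    (mul_le_of_le_one_right (v.nonneg _) (H.map_sum_le zero_le_one fun j _ => ?_))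
  rw [map_mul, map_pow, map_pow]
  exact mul_le_one₀ (pow_le_one₀ (v.nonneg _) hξ) (by positivity) (pow_le_one₀ (v.nonneg _) hη)

theorem one_le_sub [IsAlgClosed k] (H : IsAdicExtension φ v ρ) {f g : k[X]}
    (h : ∀ c, f.IsRoot c → g.IsRoot c → c = 0) {ξ η : L} (hξ : v ξ = 1) (hη : v η ≤ 1)
    (hf : v (f.eval₂ (φ.comp PowerSeries.C) ξ) < 1)
    (hg : v (g.eval₂ (φ.comp PowerSeries.C) η) < 1) : 1 ≤ v (ξ - η) := by
  by_contra! hlt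
  obtain ⟨a, b, n, hab⟩ := exists_add_eq_X_pow h
  have hg' : v (g.eval₂ (φ.comp PowerSeries.C) ξ) < 1 := by
    rw [← sub_add_cancel (g.eval₂ (φ.comp PowerSeries.C) ξ) (g.eval₂ (φ.comp PowerSeries.C) η)]
    exact (H.isNonarchimedean _ _).trans_lt
      (max_lt ((H.eval₂_sub_eval₂_le g hξ.le hη).trans_lt hlt) hg)
  have mul_lt_one {f : k[X]} (a : k[X]) (hf : v (f.eval₂ (φ.comp PowerSeries.C) ξ) < 1) :
      v ((f * a).eval₂ (φ.comp PowerSeries.C) ξ) < 1 := by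
    rw [Polynomial.eval₂_mul, map_mul]
    exact (mul_le_of_le_one_right (v.nonneg _) (H.eval₂_le_one a hξ.le)).trans_lt hf
  have pow_lt_one : v ((f * a + g * b).eval₂ (φ.comp PowerSeries.C) ξ) < 1 := by
    rw [Polynomial.eval₂_add]
    exact (H.isNonarchimedean _ _).trans_lt (max_lt (mul_lt_one a hf) (mul_lt_one b hg'))
  rw [hab, Polynomial.eval₂_pow, Polynomial.eval₂_X, map_pow, hξ, one_pow] at pow_lt_one
  exact lt_irrefl _ pow_lt_one

end IsAdicExtension

/-- No two initial forms of `P` and `Q` with respect to the same degrees have a common zero off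
the coordinate axes; `z₂` may have degree `0`. -/
def InitialFormsCoprime {k : Type*} [Semiring k] (P Q : (PowerSeries k)[X]) : Prop :=
  ∀ q p : ℕ, 0 < p → ∀ c, (initialPoly P q p).IsRoot c → (initialPoly Q q p).IsRoot c → c = 0

namespace IsAdicExtension

variable {k L : Type*} [Field k] [Field L] {φ : PowerSeries k →+* L} {v : AbsoluteValue L ℝ}
  {ρ : ℝ} {P Q : (PowerSeries k)[X]}

theorem exists_eq_rpow [IsAlgClosed L] (H : IsAdicExtension φ v ρ) (hP : P.Monic)
    (h0 : P.coeff 0 ≠ 0) {α : L} (hα : (P.map φ).IsRoot α) :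
    ∃ (q p : ℕ) (ζ : L), 0 < p ∧ ζ ^ p = φ PowerSeries.X ∧ v α = v (ζ ^ q) := by
  have hmem : ord v ρ α ∈ (P.map φ).roots.map (ord v ρ) :=
    Multiset.mem_map_of_mem _ ((Polynomial.mem_roots (hP.map φ).ne_zero).2 hα)
  set p := ((P.map φ).roots.map (ord v ρ)).count (ord v ρ α) with hp_def
  have hp : 0 < p := Multiset.count_pos.2 hmem
  obtain ⟨q, hq⟩ := (H.hasSlopes_roots hP h0).exists_natCast_eq_count_mul
    (H.ord_nonneg (H.root_le_one hP hα))
  rw [← hp_def] at hq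
  obtain ⟨ζ, hζ⟩ := IsAlgClosed.exists_pow_nat_eq (φ PowerSeries.X) hp
  have hρ : ρ = v ζ ^ p := by rw [← map_pow, hζ, H.map_X]
  refine ⟨q, p, ζ, hp, hζ, ?_⟩
  rw [map_pow, ← Real.rpow_natCast (v ζ) q, hq, Real.rpow_mul (v.nonneg _), Real.rpow_natCast,
    ← hρ, ord, Real.rpow_logb H.pos H.lt_one.ne (v.pos (H.root_ne_zero h0 hα))]

theorem map_sub_eq_max [IsAlgClosed k] [IsAlgClosed L] (H : IsAdicExtension φ v ρ) (hP : P.Monic)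
    (h0 : P.coeff 0 ≠ 0) (h : InitialFormsCoprime P Q) {α β : L} (hα : (P.map φ).IsRoot α)
    (hβ : (Q.map φ).IsRoot β) : v (α - β) = max (v α) (v β) := by
  rcases ne_or_eq (v α) (v β) with hne | heq
  · rw [sub_eq_add_neg, H.isNonarchimedean.add_eq_max_of_ne (by rwa [v.map_neg]), v.map_neg]
  obtain ⟨q, p, ζ, hp, hζ, hαζ⟩ := H.exists_eq_rpow hP h0 hα
  have hζq : ζ ^ q ≠ 0 := by
    rw [← v.ne_zero_iff, ← hαζ, v.ne_zero_iff]
    exact H.root_ne_zero h0 hα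
  obtain ⟨ξ, rfl⟩ : ∃ ξ, α = ξ * ζ ^ q := ⟨α / ζ ^ q, (div_mul_cancel₀ _ hζq).symm⟩
  obtain ⟨η, rfl⟩ : ∃ η, β = η * ζ ^ q := ⟨β / ζ ^ q, (div_mul_cancel₀ _ hζq).symm⟩
  have hζq' : 0 < v (ζ ^ q) := v.pos hζq
  have hξ : v ξ = 1 := by rwa [map_mul, mul_eq_right₀ hζq'.ne'] at hαζ
  have hη : v η = 1 := by rwa [heq, map_mul, mul_eq_right₀ hζq'.ne'] at hαζ
  have one_le : 1 ≤ v (ξ - η) := H.one_le_sub (h q p hp) hξ hη.le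
    (H.eval₂_initialPoly_lt_one hp hζ hξ.le hα) (H.eval₂_initialPoly_lt_one hp hζ hη.le hβ)
  refine le_antisymm ?_ ?_
  · simpa only [sub_eq_add_neg, v.map_neg] using H.isNonarchimedean (ξ * ζ ^ q) (-(η * ζ ^ q))
  · rw [← sub_mul, map_mul, map_mul, map_mul, hξ, hη, max_self]
    exact mul_le_mul_of_nonneg_right one_le hζq'.le

end IsAdicExtension

theorem hullOf_exponents_resultantPoly {k : Type*} [Field k] [IsAlgClosed k]
    {P Q : (PowerSeries k)[X]} (hP : P.Monic) (hQ : Q.Monic) (hP0 : P.coeff 0 ≠ 0)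
    (hQ0 : Q.coeff 0 ≠ 0) (h : InitialFormsCoprime P Q) :
    hullOf (exponents (resultantPoly P Q)) =
      polygonMul (hullOf (exponents P)) (hullOf (exponents Q)) := by
  obtain ⟨L, _, _, φ, v, ρ, H⟩ := exists_isAdicExtension k
  exact hullOf_eq_polygonMul (H.hasSlopes_roots hP hP0) (H.hasSlopes_roots hQ hQ0)
    (H.hasSlopes_resultantPoly hP hQ hP0 hQ0 fun _ _ => H.map_sub_eq_max hP hP0 h)

/-! ### Compact edges -/

/-- The face of `N` on which `t * x + y` is minimal. -/
def slopeFace (N : Set (ℝ × ℝ)) (t : ℝ) : Set (ℝ × ℝ) :=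
  {x ∈ N | ∀ y ∈ N, weight t x ≤ weight t y}

theorem isCompactEdge_iff {N γ : Set (ℝ × ℝ)} :
    IsCompactEdge N γ ↔ γ.Nontrivial ∧ ∃ t : ℝ, 0 < t ∧ γ = slopeFace N t := by
  refine and_congr_right fun _ => ⟨?_, ?_⟩
  · rintro ⟨u, v, hu, hv, rfl⟩
    have weight_eq (x : ℝ × ℝ) : u * x.1 + v * x.2 = v * weight (u / v) x := by
      rw [weight_apply]
      field_simp
    refine ⟨u / v, div_pos hu hv, ?_⟩
    simp only [slopeFace, weight_eq, mul_le_mul_iff_right₀ hv]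
  · rintro ⟨t, ht, rfl⟩
    exact ⟨t, 1, ht, one_pos, by simp only [slopeFace, weight_apply, one_mul]⟩

theorem isCompactEdge_slopeFace {N : Set (ℝ × ℝ)} {t : ℝ} (ht : 0 < t)
    (h : (slopeFace N t).Nontrivial) : IsCompactEdge N (slopeFace N t) :=
  isCompactEdge_iff.2 ⟨h, t, ht, rfl⟩

theorem weight_eq_of_mem_slopeFace {N : Set (ℝ × ℝ)} {t : ℝ} {x y : ℝ × ℝ}
    (hx : x ∈ slopeFace N t) (hy : y ∈ slopeFace N t) : weight t x = weight t y :=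
  le_antisymm (hx.2 y hy.1) (hy.2 x hx.1)

theorem toPlane_mem_slopeFace_iff {S : Set (ℕ × ℕ)} {t : ℝ} (ht : 0 ≤ t) {a : ℕ × ℕ}
    (ha : a ∈ S) :
    toPlane a ∈ slopeFace (hullOf S) t ↔ ∀ b ∈ S, weight t (toPlane a) ≤ weight t (toPlane b) :=
  ⟨fun h _ hb => h.2 _ (toPlane_mem_hullOf hb),
    fun h => ⟨toPlane_mem_hullOf ha, fun _ hy => le_weight_of_mem_hullOf ht h hy⟩⟩

theorem injOn_fst_preimage_slopeFace (N : Set (ℝ × ℝ)) (t : ℝ) :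
    Set.InjOn Prod.fst (toPlane ⁻¹' slopeFace N t) := by
  intro a ha b hb hab
  have := weight_eq_of_mem_slopeFace ha hb
  simp only [weight_apply, toPlane, hab, add_right_inj, Nat.cast_inj] at this
  exact Prod.ext hab this

theorem finite_preimage_slopeFace (N : Set (ℝ × ℝ)) {t : ℝ} (ht : 0 < t) :
    (toPlane ⁻¹' slopeFace N t).Finite := by
  rcases (toPlane ⁻¹' slopeFace N t).eq_empty_or_nonempty with h | ⟨b, hb⟩
  · rw [h]
    exact Set.finite_empty
  set m := weight t (toPlane b)
  refine (Set.finite_Iic (⌊m / t⌋₊, ⌊m⌋₊)).subset fun a ha => ?_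
  have ham : t * a.1 + a.2 = m := by
    simpa only [weight_apply, toPlane, m] using weight_eq_of_mem_slopeFace ha hb
  refine ⟨Nat.le_floor ?_, Nat.le_floor ?_⟩
  · rw [le_div_iff₀ ht, mul_comm, ← ham]
    exact le_add_of_nonneg_right a.2.cast_nonneg
  · rw [← ham]
    exact le_add_of_nonneg_left (by positivity)

theorem slopeFace_hullOf_subset (S : Set (ℕ × ℕ)) {t : ℝ} (ht : 0 < t) :
    slopeFace (hullOf S) t ⊆ convexHull ℝ (toPlane '' S ∩ slopeFace (hullOf S) t) := by
  intro x hx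
  have hx' := hx.1
  rw [hullOf_eq_add] at hx'
  obtain ⟨y, hy, z, ⟨hz1, hz2⟩, rfl⟩ := hx'
  rw [Set.mem_Ici] at hz1 hz2
  beta_reduce at hx ⊢
  have hy' : y ∈ hullOf S := by
    rw [hullOf_eq_add]
    exact ⟨y, hy, 0, ⟨Set.self_mem_Ici, Set.self_mem_Ici⟩, add_zero y⟩
  obtain rfl : z = 0 := by
    have hle := hx.2 y hy'
    rw [map_add, add_le_iff_nonpos_right, weight_apply] at hle
    have htz : 0 ≤ t * z.1 := mul_nonneg ht.le hz1
    have hz1' : t * z.1 = 0 := htz.antisymm' (by linarith)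
    exact Prod.ext ((mul_eq_zero.1 hz1').resolve_left ht.ne') (hz2.antisymm' (by linarith))
  rw [add_zero] at hx ⊢
  have weight_le : ∀ p ∈ toPlane '' S, weight t y ≤ weight t p := fun p ⟨a, ha, hap⟩ =>
    hx.2 p (hap ▸ toPlane_mem_hullOf ha)
  refine convexHull_mono ?_ (mem_convexHull_inter_of_forall_le (weight t) weight_le hy rfl)
  rintro _ ⟨⟨a, ha, rfl⟩, hax⟩
  exact ⟨⟨a, ha, rfl⟩, toPlane_mem_hullOf ha, fun w hw => hax.symm ▸ hx.2 w hw⟩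

theorem nontrivial_inter_slopeFace {S : Set (ℕ × ℕ)} {t : ℝ} (ht : 0 < t)
    (h : (slopeFace (hullOf S) t).Nontrivial) :
    (S ∩ toPlane ⁻¹' slopeFace (hullOf S) t).Nontrivial := by
  by_contra hsub
  have image_subsingleton : (toPlane '' S ∩ slopeFace (hullOf S) t).Subsingleton := by
    rw [← Set.image_inter_preimage]
    exact (Set.not_nontrivial_iff.1 hsub).image _
  have hull_eq := image_subsingleton.convex.convexHull_eq (𝕜 := ℝ)
  exact (image_subsingleton.anti (hull_eq ▸ slopeFace_hullOf_subset S ht)).not_nontrivial h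

theorem mem_of_forall_lt {S : Set (ℕ × ℕ)} {t : ℝ} (ht : 0 < t) (f : (ℝ × ℝ) →ₗ[ℝ] ℝ) {a : ℕ × ℕ}
    (ha : toPlane a ∈ slopeFace (hullOf S) t)
    (hf : ∀ b, toPlane b ∈ slopeFace (hullOf S) t → b ≠ a → f (toPlane a) < f (toPlane b)) :
    a ∈ S := by
  have hull_mem := mem_convexHull_inter_of_forall_le f (m := f (toPlane a)) (fun x hx => ?_)
    (slopeFace_hullOf_subset S ht ha) rfl
  · obtain ⟨_, ⟨⟨b, hb, rfl⟩, hbf⟩, hba⟩ := convexHull_nonempty_iff.1 ⟨_, hull_mem⟩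
    by_contra haS
    exact (hf b hbf fun h => haS (h ▸ hb)).ne' hba
  · obtain ⟨⟨b, -, rfl⟩, hbf⟩ := hx
    rcases eq_or_ne b a with rfl | hba
    · exact le_rfl
    · exact (hf b hbf hba).le

theorem finite_setOf_nontrivial_slopeFace {N : Set (ℝ × ℝ)} (hN : IsNewtonPolygon N) :
    {t : ℝ | 0 < t ∧ (slopeFace N t).Nontrivial}.Finite := by
  obtain ⟨S, -, rfl⟩ := hN
  obtain ⟨T, hT, hTS⟩ := exists_finite_hullOf_eq S
  rw [← hTS]
  refine ((hT.prod hT).image fun ab : (ℕ × ℕ) × ℕ × ℕ =>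
    ((ab.2.2 - ab.1.2 : ℝ) / (ab.1.1 - ab.2.1))).subset ?_
  rintro t ⟨ht, h⟩
  obtain ⟨a, ⟨haT, ha⟩, b, ⟨hbT, hb⟩, hab⟩ := nontrivial_inter_slopeFace ht h
  refine ⟨(a, b), ⟨haT, hbT⟩, ?_⟩
  have hne : (a.1 - b.1 : ℝ) ≠ 0 := fun h0 =>
    hab (injOn_fst_preimage_slopeFace _ t ha hb (Nat.cast_injective (sub_eq_zero.1 h0)))
  have hw := weight_eq_of_mem_slopeFace ha hb
  simp only [weight_apply, toPlane] at hw
  rw [div_eq_iff hne]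
  linarith

/-- The lattice points on the face of `N` on which `t * x + y` is minimal. -/
noncomputable def facePoints (N : Set (ℝ × ℝ)) {t : ℝ} (ht : 0 < t) : Finset (ℕ × ℕ) :=
  (finite_preimage_slopeFace N ht).toFinset

@[simp]
theorem mem_facePoints {N : Set (ℝ × ℝ)} {t : ℝ} {ht : 0 < t} {a : ℕ × ℕ} :
    a ∈ facePoints N ht ↔ toPlane a ∈ slopeFace N t := by
  simp [facePoints]

theorem injOn_fst_facePoints (N : Set (ℝ × ℝ)) {t : ℝ} (ht : 0 < t) :
    Set.InjOn Prod.fst (facePoints N ht : Set (ℕ × ℕ)) := by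
  simpa [facePoints] using injOn_fst_preimage_slopeFace N t

/-- `a` and `b` are the left and the right end points of the edge of `N` on which `t * x + y` is
minimal. -/
structure IsEndpoints (N : Set (ℝ × ℝ)) {t : ℝ} (ht : 0 < t) (a b : ℕ × ℕ) : Prop where
  left_mem : a ∈ facePoints N ht
  right_mem : b ∈ facePoints N ht
  lt : a.1 < b.1
  le_fst : ∀ c ∈ facePoints N ht, a.1 ≤ c.1
  fst_le : ∀ c ∈ facePoints N ht, c.1 ≤ b.1

theorem exists_isEndpoints {N : Set (ℝ × ℝ)} (hN : IsNewtonPolygon N) {t : ℝ} (ht : 0 < t)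
    (h : (slopeFace N t).Nontrivial) : ∃ a b, IsEndpoints N ht a b := by
  obtain ⟨S, -, rfl⟩ := hN
  obtain ⟨c, ⟨-, hc⟩, d, ⟨-, hd⟩, hcd⟩ := nontrivial_inter_slopeFace ht h
  rw [Set.mem_preimage, ← mem_facePoints (ht := ht)] at hc hd
  obtain ⟨a, ha, ha_le⟩ := (facePoints (hullOf S) ht).exists_min_image Prod.fst ⟨c, hc⟩
  obtain ⟨b, hb, le_hb⟩ := (facePoints (hullOf S) ht).exists_max_image Prod.fst ⟨c, hc⟩
  refine ⟨a, b, ha, hb, ?_, ha_le, le_hb⟩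
  have hne : c.1 ≠ d.1 := fun h0 => hcd (injOn_fst_facePoints _ ht hc hd h0)
  have := ha_le c hc
  have := ha_le d hd
  have := le_hb c hc
  have := le_hb d hd
  omega

namespace IsEndpoints

variable {S : Set (ℕ × ℕ)} {t : ℝ} {ht : 0 < t} {a b : ℕ × ℕ}

theorem left_mem_of_hullOf (h : IsEndpoints (hullOf S) ht a b) : a ∈ S := by
  refine mem_of_forall_lt ht (LinearMap.fst ℝ ℝ ℝ) (mem_facePoints.1 h.left_mem) fun c hc hca => ?_
  rw [← mem_facePoints (ht := ht)] at hc
  refine Nat.cast_lt.2 ((h.le_fst c hc).lt_of_ne fun h0 => hca ?_)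
  exact injOn_fst_facePoints _ ht hc h.left_mem h0.symm

theorem right_mem_of_hullOf (h : IsEndpoints (hullOf S) ht a b) : b ∈ S := by
  refine mem_of_forall_lt ht (-LinearMap.fst ℝ ℝ ℝ) (mem_facePoints.1 h.right_mem)
    fun c hc hcb => ?_
  rw [← mem_facePoints (ht := ht)] at hc
  refine neg_lt_neg (Nat.cast_lt.2 ((h.fst_le c hc).lt_of_ne fun h0 => hcb ?_))
  exact injOn_fst_facePoints _ ht hc h.right_mem h0

end IsEndpoints

/-! ### Edge polynomials -/

theorem edgePolynomial_slopeFace (P : Cz[X]) (N : Set (ℝ × ℝ)) {t : ℝ} (ht : 0 < t) :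
    edgePolynomial P (slopeFace N t) = ∑ a ∈ facePoints N ht,
      Polynomial.monomial a.1 (Polynomial.monomial a.2 (coeffAt P a.1 a.2)) :=
  finsum_mem_eq_finite_toFinset_sum _ (finite_preimage_slopeFace N ht)

theorem evalEval_edgePolynomial (P : Cz[X]) (N : Set (ℝ × ℝ)) {t : ℝ} (ht : 0 < t) (x y : ℂ) :
    (edgePolynomial P (slopeFace N t)).evalEval x y =
      ∑ a ∈ facePoints N ht, coeffAt P a.1 a.2 * x ^ a.2 * y ^ a.1 := by
  rw [edgePolynomial_slopeFace P N ht, Polynomial.evalEval_finsetSum]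
  refine Finset.sum_congr rfl fun a _ => ?_
  simp [Polynomial.evalEval]

theorem evalEval_edgePolynomial_cpow_eq_zero_iff (P : Cz[X]) (N : Set (ℝ × ℝ)) {t : ℝ} (ht : 0 < t)
    {x : ℂ} (hx : x ≠ 0) (c : ℂ) :
    (edgePolynomial P (slopeFace N t)).evalEval x (c * x ^ (t : ℂ)) = 0 ↔
      (edgePolynomial P (slopeFace N t)).evalEval 1 c = 0 := by
  obtain ⟨m, hm⟩ : ∃ m : ℝ, ∀ a ∈ facePoints N ht, t * a.1 + a.2 = m := by
    rcases (facePoints N ht).eq_empty_or_nonempty with h | ⟨b, hb⟩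
    · exact ⟨0, by simp [h]⟩
    · refine ⟨t * b.1 + b.2, fun a ha => ?_⟩
      simpa [toPlane] using
        weight_eq_of_mem_slopeFace (mem_facePoints.1 ha) (mem_facePoints.1 hb)
  have quasihomogeneous : (edgePolynomial P (slopeFace N t)).evalEval x (c * x ^ (t : ℂ)) =
      x ^ (m : ℂ) * (edgePolynomial P (slopeFace N t)).evalEval 1 c := by
    rw [evalEval_edgePolynomial P N ht, evalEval_edgePolynomial P N ht, Finset.mul_sum]
    refine Finset.sum_congr rfl fun a ha => ?_
    rw [← hm a ha, Complex.ofReal_add, Complex.ofReal_mul, Complex.ofReal_natCast,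
      Complex.ofReal_natCast, Complex.cpow_add _ _ hx, Complex.cpow_mul_nat,
      Complex.cpow_natCast, one_pow, mul_pow]
    ring
  rw [quasihomogeneous, mul_eq_zero, or_iff_right]
  rw [Complex.cpow_eq_zero_iff]
  exact fun h => hx h.1

/-- The polynomial in one variable with coefficient `w a` at the exponent `a.1 - d` for `a ∈ s`.
When `s` consists of the lattice points of an edge, `w` of the coefficients of `P` and `d` is the
smallest exponent, this is the edge polynomial of `P` at `z₁ = 1`, divided by `z₂ ^ d`. -/
noncomputable def strippedPoly {A : Type*} [Semiring A] (s : Finset (ℕ × ℕ)) (d : ℕ)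
    (w : ℕ × ℕ → A) : A[X] :=
  ∑ a ∈ s, Polynomial.monomial (a.1 - d) (w a)

theorem map_strippedPoly {A B : Type*} [Semiring A] [Semiring B] (f : A →+* B)
    (s : Finset (ℕ × ℕ)) (d : ℕ) (w : ℕ × ℕ → A) :
    (strippedPoly s d w).map f = strippedPoly s d (f ∘ w) := by
  simp [strippedPoly, Polynomial.map_sum]

theorem strippedPoly_congr {A : Type*} [Semiring A] {s : Finset (ℕ × ℕ)} {d : ℕ}
    {w w' : ℕ × ℕ → A} (h : Set.EqOn w w' s) : strippedPoly s d w = strippedPoly s d w' :=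
  Finset.sum_congr rfl fun a ha => by rw [h ha]

theorem strippedPoly_single {A : Type*} [Semiring A] {s : Finset (ℕ × ℕ)} {b : ℕ × ℕ} (hb : b ∈ s)
    (d : ℕ) (r : A) :
    strippedPoly s d (Pi.single b r) = Polynomial.monomial (b.1 - d) r := by
  rw [strippedPoly, Finset.sum_eq_single_of_mem b hb, Pi.single_eq_same]
  intro e _ hne
  rw [Pi.single_eq_of_ne hne, map_zero]

namespace IsEndpoints

variable {N : Set (ℝ × ℝ)} {t : ℝ} {ht : 0 < t} {a b : ℕ × ℕ}

theorem evalEval_edgePolynomial_one (h : IsEndpoints N ht a b) (P : Cz[X]) (c : ℂ) :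
    (edgePolynomial P (slopeFace N t)).evalEval 1 c =
      c ^ a.1 * (strippedPoly (facePoints N ht) a.1 fun e => coeffAt P e.1 e.2).eval c := by
  rw [evalEval_edgePolynomial P N ht, strippedPoly, Polynomial.eval_finsetSum, Finset.mul_sum]
  refine Finset.sum_congr rfl fun e he => ?_
  rw [one_pow, mul_one, Polynomial.eval_monomial, mul_left_comm, ← pow_add,
    Nat.add_sub_cancel' (h.le_fst e he)]

section Semiring

variable {A : Type*} [Semiring A] {w : ℕ × ℕ → A}

theorem coeff_strippedPoly (h : IsEndpoints N ht a b) {e : ℕ × ℕ} (he : e ∈ facePoints N ht) :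
    (strippedPoly (facePoints N ht) a.1 w).coeff (e.1 - a.1) = w e := by
  rw [strippedPoly, Polynomial.finsetSum_coeff, Finset.sum_eq_single_of_mem e he,
    Polynomial.coeff_monomial_same]
  intro e' he' hne
  refine Polynomial.coeff_monomial_of_ne _ fun heq => hne (injOn_fst_facePoints N ht he' he ?_)
  exact (tsub_left_inj (h.le_fst e' he') (h.le_fst e he)).1 heq.symm

theorem natDegree_strippedPoly (h : IsEndpoints N ht a b) (hw : w b ≠ 0) :
    (strippedPoly (facePoints N ht) a.1 w).natDegree = b.1 - a.1 := by
  refine le_antisymm ?_ (Polynomial.le_natDegree_of_ne_zero ?_)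
  · exact Polynomial.natDegree_sum_le_of_forall_le _ _ fun e he =>
      (Polynomial.natDegree_monomial_le _).trans (Nat.sub_le_sub_right (h.fst_le e he) _)
  · rwa [h.coeff_strippedPoly h.right_mem]

theorem strippedPoly_ne_zero (h : IsEndpoints N ht a b) (hw : w b ≠ 0) :
    strippedPoly (facePoints N ht) a.1 w ≠ 0 := by
  refine Polynomial.ne_zero_of_natDegree_gt (n := 0) ?_
  rw [h.natDegree_strippedPoly hw]
  exact Nat.sub_pos_of_lt h.lt

theorem eval_zero_strippedPoly (h : IsEndpoints N ht a b) :
    (strippedPoly (facePoints N ht) a.1 w).eval 0 = w a := by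
  rw [← Polynomial.coeff_zero_eq_eval_zero, ← h.coeff_strippedPoly (w := w) h.left_mem,
    Nat.sub_self]

end Semiring

theorem coeffAt_left_ne_zero (h : IsEndpoints N ht a b) {P : Cz[X]} (hP : newtonPolygon P = N) :
    coeffAt P a.1 a.2 ≠ 0 := by
  subst hP
  exact h.left_mem_of_hullOf

theorem coeffAt_right_ne_zero (h : IsEndpoints N ht a b) {P : Cz[X]} (hP : newtonPolygon P = N) :
    coeffAt P b.1 b.2 ≠ 0 := by
  subst hP
  exact h.right_mem_of_hullOf

end IsEndpoints

/-! ### General position -/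

theorem exists_abs_log_sub_le {N : Set (ℝ × ℝ)} (hN : IsNewtonPolygon N) {t : ℝ} (ht : 0 < t)
    (h : (slopeFace N t).Nontrivial) {P : Cz[X]} (hP : newtonPolygon P = N) :
    ∃ C : ℝ, ∀ z : ℂ × ℂ, z.1 ≠ 0 → z.2 ≠ 0 →
      (edgePolynomial P (slopeFace N t)).evalEval z.1 z.2 = 0 →
        |Real.log ‖z.2‖ - t * Real.log ‖z.1‖| ≤ C := by
  obtain ⟨a, b, hab⟩ := exists_isEndpoints hN ht h
  set f := strippedPoly (facePoints N ht) a.1 fun e => coeffAt P e.1 e.2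
  have hf : f ≠ 0 := hab.strippedPoly_ne_zero (hab.coeffAt_right_ne_zero hP)
  refine ⟨∑ c ∈ f.roots.toFinset, |Real.log ‖c‖|, fun ⟨x, y⟩ hx hy hxy => ?_⟩
  dsimp only at hx hy hxy ⊢
  have hxt : x ^ (t : ℂ) ≠ 0 := fun h0 => hx (Complex.cpow_eq_zero_iff _ _ |>.1 h0).1
  obtain ⟨c, rfl⟩ : ∃ c, y = c * x ^ (t : ℂ) := ⟨y / x ^ (t : ℂ), (div_mul_cancel₀ _ hxt).symm⟩
  have hc : c ≠ 0 := left_ne_zero_of_mul hy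
  rw [evalEval_edgePolynomial_cpow_eq_zero_iff P N ht hx, hab.evalEval_edgePolynomial_one,
    mul_eq_zero, or_iff_right (pow_ne_zero _ hc)] at hxy
  have log_eq : Real.log ‖c * x ^ (t : ℂ)‖ - t * Real.log ‖x‖ = Real.log ‖c‖ := by
    rw [norm_mul, Real.log_mul (norm_ne_zero_iff.2 hc) (norm_ne_zero_iff.2 hxt),
      Complex.norm_cpow_real, Real.log_rpow (norm_pos_iff.2 hx), add_sub_cancel_right]
  rw [log_eq]
  refine Finset.single_le_sum (f := fun c : ℂ => |Real.log ‖c‖|) (fun _ _ => abs_nonneg _) ?_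
  rwa [Multiset.mem_toFinset, Polynomial.mem_roots hf]

theorem eventually_not_common_zero_of_ne {N₁ N₂ : Set (ℝ × ℝ)} (hN₁ : IsNewtonPolygon N₁)
    (hN₂ : IsNewtonPolygon N₂) {s t : ℝ} (hs : 0 < s) (ht : 0 < t) (hst : s ≠ t)
    (h₁ : (slopeFace N₁ s).Nontrivial) (h₂ : (slopeFace N₂ t).Nontrivial) {P₁ P₂ : Cz[X]}
    (hP₁ : newtonPolygon P₁ = N₁) (hP₂ : newtonPolygon P₂ = N₂) :
    ∀ᶠ z : ℂ × ℂ in 𝓝 0, z.1 ≠ 0 → z.2 ≠ 0 →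
      ¬ ((edgePolynomial P₁ (slopeFace N₁ s)).evalEval z.1 z.2 = 0 ∧
        (edgePolynomial P₂ (slopeFace N₂ t)).evalEval z.1 z.2 = 0) := by
  obtain ⟨C₁, hC₁⟩ := exists_abs_log_sub_le hN₁ hs h₁ hP₁
  obtain ⟨C₂, hC₂⟩ := exists_abs_log_sub_le hN₂ ht h₂ hP₂
  have hst' : 0 < |s - t| := abs_pos.2 (sub_ne_zero.2 hst)
  have eventually_lt : ∀ᶠ z : ℂ × ℂ in 𝓝 0, ‖z.1‖ < Real.exp (-((C₁ + C₂) / |s - t|)) := by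
    have : Continuous fun z : ℂ × ℂ => ‖z.1‖ := by fun_prop
    exact this.continuousAt.eventually_lt continuousAt_const (by simpa using Real.exp_pos _)
  filter_upwards [eventually_lt] with z hz hz1 hz2 ⟨hzero₁, hzero₂⟩
  rw [← Real.log_lt_iff_lt_exp (norm_pos_iff.2 hz1), lt_neg, div_lt_iff₀ hst'] at hz
  have log_mul_le : -Real.log ‖z.1‖ * |s - t| ≤ C₂ + C₁ := calc
    _ ≤ |Real.log ‖z.1‖ * (s - t)| := by
        rw [abs_mul]
        gcongr
        exact neg_le_abs _
    _ = |(Real.log ‖z.2‖ - t * Real.log ‖z.1‖) - (Real.log ‖z.2‖ - s * Real.log ‖z.1‖)| := by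
        ring_nf
    _ ≤ C₂ + C₁ := (abs_sub _ _).trans (add_le_add (hC₂ z hz1 hz2 hzero₂) (hC₁ z hz1 hz2 hzero₁))
  linarith

theorem edgesInGeneralPosition_iff {N₁ N₂ : Set (ℝ × ℝ)} (hN₁ : IsNewtonPolygon N₁)
    (hN₂ : IsNewtonPolygon N₂) {P₁ P₂ : Cz[X]} (hP₁ : newtonPolygon P₁ = N₁)
    (hP₂ : newtonPolygon P₂ = N₂) :
    EdgesInGeneralPosition N₁ N₂ P₁ P₂ ↔
      ∀ t : ℝ, 0 < t → (slopeFace N₁ t).Nontrivial → (slopeFace N₂ t).Nontrivial →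
        ∀ c ≠ 0, ¬ ((edgePolynomial P₁ (slopeFace N₁ t)).evalEval 1 c = 0 ∧
          (edgePolynomial P₂ (slopeFace N₂ t)).evalEval 1 c = 0) := by
  constructor
  · rintro h t ht h₁ h₂ c hc ⟨hc₁, hc₂⟩
    have curve_tendsto : Filter.Tendsto (fun x : ℂ => (x, c * x ^ (t : ℂ))) (𝓝 0) (𝓝 0) := by
      have : ContinuousAt (fun x : ℂ => (x, c * x ^ (t : ℂ))) 0 := continuousAt_id.prodMk
        (continuousAt_const.mul (Complex.continuousAt_cpow_const_of_re_pos (Or.inl le_rfl) ht))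
      simpa [ContinuousAt, ht.ne', Prod.zero_eq_mk] using this
    have eventually_ne := (curve_tendsto.mono_left (nhdsWithin_le_nhds (s := {0}ᶜ))).eventually
      (h _ _ (isCompactEdge_slopeFace ht h₁) (isCompactEdge_slopeFace ht h₂))
    obtain ⟨x, hx, hx0⟩ := (eventually_ne.and self_mem_nhdsWithin).exists
    refine hx hx0 (mul_ne_zero hc ?_) ⟨?_, ?_⟩
    · exact fun h0 => hx0 (Complex.cpow_eq_zero_iff _ _ |>.1 h0).1
    · exact (evalEval_edgePolynomial_cpow_eq_zero_iff P₁ N₁ ht hx0 c).2 hc₁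
    · exact (evalEval_edgePolynomial_cpow_eq_zero_iff P₂ N₂ ht hx0 c).2 hc₂
  · rintro h γ₁ γ₂ hγ₁ hγ₂
    obtain ⟨h₁, s, hs, rfl⟩ := isCompactEdge_iff.1 hγ₁
    obtain ⟨h₂, t, ht, rfl⟩ := isCompactEdge_iff.1 hγ₂
    rcases ne_or_eq s t with hst | rfl
    · exact eventually_not_common_zero_of_ne hN₁ hN₂ hs ht hst h₁ h₂ hP₁ hP₂
    refine Filter.Eventually.of_forall fun ⟨x, y⟩ hx hy hxy => ?_
    dsimp only at hx hy hxy
    have hxs : x ^ (s : ℂ) ≠ 0 := fun h0 => hx (Complex.cpow_eq_zero_iff _ _ |>.1 h0).1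
    rw [← div_mul_cancel₀ y hxs, evalEval_edgePolynomial_cpow_eq_zero_iff P₁ N₁ ht hx,
      evalEval_edgePolynomial_cpow_eq_zero_iff P₂ N₂ ht hx] at hxy
    exact h s hs h₁ h₂ _ (div_ne_zero hy hxs) hxy

/-! ### The condition on the coefficients -/

theorem resultant_ne_zero_iff {k : Type*} [Field k] [IsAlgClosed k] {f g : k[X]} (hf : f ≠ 0) :
    f.resultant g ≠ 0 ↔ ∀ c, f.IsRoot c → ¬ g.IsRoot c := by
  rw [Ne, Polynomial.resultant_eq_zero_iff, not_and, not_not,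
    Polynomial.isCoprime_iff_aeval_ne_zero_of_isAlgClosed k k]
  simp only [hf, ne_eq, not_false_eq_true, true_or, forall_const, Polynomial.IsRoot,
    Polynomial.coe_aeval_eq_eval]
  exact forall_congr' fun c => imp_iff_not_or.symm

/-- Independent coefficients at the lattice points of the compact edges of `N`, the variable at
the point `a` being `ι a`; zero elsewhere. -/
noncomputable def genericCoeff {N : Set (ℝ × ℝ)} {σ : Type*} (ι : EdgePoint N → σ) :
    ℕ × ℕ → MvPolynomial σ ℂ :=
  Function.extend (fun a : EdgePoint N => a.1) (fun a => MvPolynomial.X (ι a)) 0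

theorem eval_genericCoeff {N : Set (ℝ × ℝ)} {σ : Type*} (ι : EdgePoint N → σ) (x : σ → ℂ)
    (a : EdgePoint N) : MvPolynomial.eval x (genericCoeff ι a.1) = x (ι a) := by
  have h : Function.Injective fun a : EdgePoint N => a.1 := Subtype.val_injective
  rw [genericCoeff, h.extend_apply, MvPolynomial.eval_X]

theorem map_strippedPoly_genericCoeff {N : Set (ℝ × ℝ)} {σ : Type*} (ι : EdgePoint N → σ) {t : ℝ}
    (ht : 0 < t) (h : (slopeFace N t).Nontrivial) (d : ℕ) {x : σ → ℂ} {w : ℕ × ℕ → ℂ}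
    (hx : ∀ a, x (ι a) = w a.1) :
    (strippedPoly (facePoints N ht) d (genericCoeff ι)).map (MvPolynomial.eval x) =
      strippedPoly (facePoints N ht) d w := by
  rw [map_strippedPoly]
  refine strippedPoly_congr fun a ha => ?_
  exact (eval_genericCoeff ι x
    ⟨a, slopeFace N t, isCompactEdge_slopeFace ht h, mem_facePoints.1 ha⟩).trans (hx _)

theorem IsEndpoints.isRoot_strippedPoly_iff {N : Set (ℝ × ℝ)} {t : ℝ} {ht : 0 < t} {a b : ℕ × ℕ}
    (h : IsEndpoints N ht a b) {P : Cz[X]} (hP : newtonPolygon P = N) (c : ℂ) :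
    (strippedPoly (facePoints N ht) a.1 fun e => coeffAt P e.1 e.2).IsRoot c ↔
      c ≠ 0 ∧ (edgePolynomial P (slopeFace N t)).evalEval 1 c = 0 := by
  rcases eq_or_ne c 0 with rfl | hc
  · rw [Polynomial.IsRoot, h.eval_zero_strippedPoly]
    exact iff_of_false (h.coeffAt_left_ne_zero hP) fun h0 => h0.1 rfl
  · rw [h.evalEval_edgePolynomial_one, mul_eq_zero, or_iff_right (pow_ne_zero _ hc)]
    exact (and_iff_right hc).symm

theorem exists_mvPolynomial_of_slope {N₁ N₂ : Set (ℝ × ℝ)} (hN₁ : IsNewtonPolygon N₁)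
    (hN₂ : IsNewtonPolygon N₂) {t : ℝ} (ht : 0 < t) (h₁ : (slopeFace N₁ t).Nontrivial)
    (h₂ : (slopeFace N₂ t).Nontrivial) :
    ∃ G : MvPolynomial (EdgePoint N₁ ⊕ EdgePoint N₂) ℂ, G ≠ 0 ∧
      ∀ P₁ P₂ : Cz[X], newtonPolygon P₁ = N₁ → newtonPolygon P₂ = N₂ →
        ((∀ c ≠ 0, ¬ ((edgePolynomial P₁ (slopeFace N₁ t)).evalEval 1 c = 0 ∧
          (edgePolynomial P₂ (slopeFace N₂ t)).evalEval 1 c = 0)) ↔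
        MvPolynomial.eval (edgeCoeffs N₁ N₂ P₁ P₂) G ≠ 0) := by
  obtain ⟨a, b, hab⟩ := exists_isEndpoints hN₁ ht h₁
  obtain ⟨a', b', hab'⟩ := exists_isEndpoints hN₂ ht h₂
  let G : MvPolynomial (EdgePoint N₁ ⊕ EdgePoint N₂) ℂ := Polynomial.resultant
    (strippedPoly (facePoints N₁ ht) a.1 (genericCoeff Sum.inl))
    (strippedPoly (facePoints N₂ ht) a'.1 (genericCoeff Sum.inr)) (b.1 - a.1) (b'.1 - a'.1)
  have eval_G_ne_zero_iff : ∀ w w' : ℕ × ℕ → ℂ, w b ≠ 0 → w' b' ≠ 0 →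
      (MvPolynomial.eval (Sum.elim (fun e => w e.1) fun e => w' e.1) G ≠ 0 ↔
        ∀ c, (strippedPoly (facePoints N₁ ht) a.1 w).IsRoot c →
          ¬ (strippedPoly (facePoints N₂ ht) a'.1 w').IsRoot c) := by
    intro w w' hw hw'
    rw [← resultant_ne_zero_iff (hab.strippedPoly_ne_zero hw), hab.natDegree_strippedPoly hw,
      hab'.natDegree_strippedPoly hw', ← Polynomial.resultant_map_map,
      map_strippedPoly_genericCoeff Sum.inl ht h₁ _ fun _ => rfl,
      map_strippedPoly_genericCoeff Sum.inr ht h₂ _ fun _ => rfl]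
  refine ⟨G, ?_, fun P₁ P₂ hP₁ hP₂ => ?_⟩
  · -- `z₂ ^ n` has no root in common with a polynomial whose constant coefficient is `1`.
    have no_common_root : ∀ c,
        (strippedPoly (facePoints N₁ ht) a.1 (Pi.single b (1 : ℂ))).IsRoot c →
          ¬ (strippedPoly (facePoints N₂ ht) a'.1 (1 : ℕ × ℕ → ℂ)).IsRoot c := by
      intro c hc
      rw [strippedPoly_single hab.right_mem, Polynomial.IsRoot, Polynomial.eval_monomial, one_mul,
        pow_eq_zero_iff (Nat.sub_ne_zero_of_lt hab.lt)] at hc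
      rw [hc, Polynomial.IsRoot, hab'.eval_zero_strippedPoly]
      exact one_ne_zero
    refine fun hG => (eval_G_ne_zero_iff (Pi.single b 1) 1 ?_ one_ne_zero).2 no_common_root ?_
    · rw [Pi.single_eq_same]
      exact one_ne_zero
    · rw [hG, map_zero]
  · refine Iff.trans ?_ (eval_G_ne_zero_iff (fun e => coeffAt P₁ e.1 e.2)
      (fun e => coeffAt P₂ e.1 e.2) (hab.coeffAt_right_ne_zero hP₁)
      (hab'.coeffAt_right_ne_zero hP₂)).symm
    simp only [hab.isRoot_strippedPoly_iff hP₁, hab'.isRoot_strippedPoly_iff hP₂]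
    exact forall_congr' fun c => by tauto

theorem exists_mvPolynomial_edgesInGeneralPosition_iff {N₁ N₂ : Set (ℝ × ℝ)}
    (hN₁ : IsNewtonPolygon N₁) (hN₂ : IsNewtonPolygon N₂) :
    ∃ F : MvPolynomial (EdgePoint N₁ ⊕ EdgePoint N₂) ℂ, F ≠ 0 ∧
      ∀ P₁ P₂ : Cz[X], newtonPolygon P₁ = N₁ → newtonPolygon P₂ = N₂ →
        (EdgesInGeneralPosition N₁ N₂ P₁ P₂ ↔
          MvPolynomial.eval (edgeCoeffs N₁ N₂ P₁ P₂) F ≠ 0) := by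
  choose! G hG0 hG using fun (t : ℝ)
    (ht : 0 < t ∧ (slopeFace N₁ t).Nontrivial ∧ (slopeFace N₂ t).Nontrivial) =>
      exists_mvPolynomial_of_slope hN₁ hN₂ ht.1 ht.2.1 ht.2.2
  have finite_slopes :
      {t | 0 < t ∧ (slopeFace N₁ t).Nontrivial ∧ (slopeFace N₂ t).Nontrivial}.Finite :=
    (finite_setOf_nontrivial_slopeFace hN₁).subset fun t ht => ⟨ht.1, ht.2.1⟩
  refine ⟨∏ t ∈ finite_slopes.toFinset, G t, ?_, fun P₁ P₂ hP₁ hP₂ => ?_⟩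
  · exact Finset.prod_ne_zero_iff.2 fun t ht => hG0 t (finite_slopes.mem_toFinset.1 ht)
  rw [edgesInGeneralPosition_iff hN₁ hN₂ hP₁ hP₂, map_prod, Finset.prod_ne_zero_iff]
  refine forall_congr' fun t => ?_
  rw [Set.Finite.mem_toFinset, Set.mem_ofPred_eq, and_imp, and_imp]
  exact forall_congr' fun ht => forall_congr' fun h₁ => forall_congr' fun h₂ =>
    hG t ⟨ht, h₁, h₂⟩ P₁ P₂ hP₁ hP₂

/-! ### Initial forms and edge polynomials -/

section

variable {k : Type*} [Semiring k] {P : (PowerSeries k)[X]} {q p : ℕ}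

theorem mem_initialIndex_iff (hp : 0 < p) {a : ℕ × ℕ} (ha : a ∈ exponents P) :
    a ∈ initialIndex P q p ↔ ∀ b ∈ exponents P, level q p a ≤ level q p b := by
  constructor
  · intro h b hb
    rw [(Finset.mem_filter.1 h).2]
    exact minLevel_le hb
  · intro h
    refine mem_initialIndex hp ha (le_antisymm ?_ (minLevel_le ha))
    exact le_csInf ⟨_, a, ha, rfl⟩ (Set.forall_mem_image.2 h)

theorem exists_mem_exponents_and_mem_initialIndex (hp : 0 < p) (hP : (exponents P).Nonempty) :
    ∃ a ∈ exponents P, a ∈ initialIndex P q p := by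
  obtain ⟨a, ha, hmin⟩ := Nat.sInf_mem (hP.image (level q p))
  exact ⟨a, ha, mem_initialIndex hp ha hmin⟩

theorem natDegree_mem_exponents [Nontrivial k] (hP : P.Monic) :
    (P.natDegree, 0) ∈ exponents P := by
  simp [exponents, hP.coeff_natDegree]

theorem initialPoly_zero_left (hP : P.Monic) (hp : 0 < p) :
    initialPoly P 0 p = P.map PowerSeries.constantCoeff := by
  nontriviality k
  have minLevel_eq : minLevel P 0 p = 0 := by
    simpa [level] using minLevel_le (q := 0) (p := p) (natDegree_mem_exponents hP)
  have snd_eq_zero {a : ℕ × ℕ} (ha : a ∈ initialIndex P 0 p) : a.2 = 0 := by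
    simpa [level, minLevel_eq, hp.ne'] using (Finset.mem_filter.1 ha).2
  ext j
  rw [initialPoly, Polynomial.finsetSum_coeff, Finset.sum_eq_single (j, 0),
    Polynomial.coeff_monomial_same, Polynomial.coeff_map, PowerSeries.coeff_zero_eq_constantCoeff]
  · rintro a ha hne
    exact Polynomial.coeff_monomial_of_ne _ fun h => hne (Prod.ext h.symm (snd_eq_zero ha))
  · intro hj
    rw [Polynomial.coeff_monomial_same]
    by_contra h0
    exact hj (mem_initialIndex hp h0 (by simp [level, minLevel_eq]))

end

theorem weight_div_toPlane {q p : ℕ} (hp : 0 < p) (a : ℕ × ℕ) :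
    weight (q / p) (toPlane a) = level q p a / p := by
  have hp' : (p : ℝ) ≠ 0 := Nat.cast_ne_zero.2 hp.ne'
  rw [weight_apply, toPlane, level]
  push_cast
  field_simp

theorem mem_initialIndex_iff_mem_slopeFace {P : Cz[X]} {q p : ℕ} (hp : 0 < p) {a : ℕ × ℕ}
    (ha : a ∈ exponents (P.map convergentSeries.subtype)) :
    a ∈ initialIndex (P.map convergentSeries.subtype) q p ↔
      toPlane a ∈ slopeFace (newtonPolygon P) (q / p) := by
  have hp' : (0 : ℝ) < p := Nat.cast_pos.2 hp
  rw [mem_initialIndex_iff hp ha, newtonPolygon_eq_hullOf_exponents,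
    toPlane_mem_slopeFace_iff (by positivity) ha]
  simp only [weight_div_toPlane hp, div_le_div_iff_of_pos_right hp', Nat.cast_le]

theorem eval_initialPoly_eq_evalEval_edgePolynomial (P : Cz[X]) {q p : ℕ} (hq : 0 < q)
    (hp : 0 < p) (c : ℂ) :
    (initialPoly (P.map convergentSeries.subtype) q p).eval c =
      (edgePolynomial P (slopeFace (newtonPolygon P) (q / p))).evalEval 1 c := by
  have ht : (0 : ℝ) < q / p := div_pos (Nat.cast_pos.2 hq) (Nat.cast_pos.2 hp)
  rw [evalEval_edgePolynomial P _ ht, initialPoly, Polynomial.eval_finsetSum]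
  have coeff_eq (a : ℕ × ℕ) :
      PowerSeries.coeff a.2 ((P.map convergentSeries.subtype).coeff a.1) = coeffAt P a.1 a.2 := by
    rw [Polynomial.coeff_map, Subring.subtype_apply, coeffAt]
  simp only [Polynomial.eval_monomial, one_pow, mul_one, coeff_eq]
  refine Finset.sum_congr_of_eq_on_inter (fun a ha ha' => ?_) (fun a ha ha' => ?_) fun _ _ _ => rfl
  all_goals
    by_contra h0
    have hmem : a ∈ exponents (P.map convergentSeries.subtype) := by
      rw [exponents, Set.mem_ofPred_eq, coeff_eq]
      exact left_ne_zero_of_mul h0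
    refine ha' ?_
  · exact mem_facePoints.2 ((mem_initialIndex_iff_mem_slopeFace hp hmem).1 ha)
  · exact (mem_initialIndex_iff_mem_slopeFace hp hmem).2 (mem_facePoints.1 ha)

theorem toPlane_injective : Function.Injective toPlane := fun _ _ h =>
  Prod.ext (Nat.cast_injective (congrArg Prod.fst h)) (Nat.cast_injective (congrArg Prod.snd h))

theorem nontrivial_slopeFace_of_evalEval_eq_zero {P : Cz[X]} {t : ℝ} (ht : 0 < t) {a : ℕ × ℕ}
    (ha : coeffAt P a.1 a.2 ≠ 0) (hat : toPlane a ∈ slopeFace (newtonPolygon P) t) {c : ℂ}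
    (hc : c ≠ 0) (h : (edgePolynomial P (slopeFace (newtonPolygon P) t)).evalEval 1 c = 0) :
    (slopeFace (newtonPolygon P) t).Nontrivial := by
  by_contra hsub
  rw [Set.not_nontrivial_iff] at hsub
  rw [evalEval_edgePolynomial P _ ht, Finset.sum_eq_single_of_mem a (mem_facePoints.2 hat)
    fun b hb hne => absurd (toPlane_injective (hsub (mem_facePoints.1 hb) hat)) hne,
    one_pow, mul_one] at h
  exact mul_ne_zero ha (pow_ne_zero _ hc) h

theorem nontrivial_slopeFace_of_isRoot_initialPoly {P : Cz[X]}
    (hP : (exponents (P.map convergentSeries.subtype)).Nonempty) {q p : ℕ} (hq : 0 < q)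
    (hp : 0 < p) {c : ℂ} (hc : c ≠ 0)
    (h : (initialPoly (P.map convergentSeries.subtype) q p).IsRoot c) :
    (slopeFace (newtonPolygon P) (q / p)).Nontrivial := by
  obtain ⟨a, ha, ha'⟩ := exists_mem_exponents_and_mem_initialIndex (q := q) hp hP
  rw [mem_initialIndex_iff_mem_slopeFace hp ha] at ha'
  rw [exponents, Set.mem_ofPred_eq, Polynomial.coeff_map] at ha
  rw [Polynomial.IsRoot, eval_initialPoly_eq_evalEval_edgePolynomial P hq hp] at h
  exact nontrivial_slopeFace_of_evalEval_eq_zero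
    (div_pos (Nat.cast_pos.2 hq) (Nat.cast_pos.2 hp)) ha ha' hc h

theorem initialFormsCoprime_of_edgesInGeneralPosition {P₁ P₂ : Cz[X]} (hP₁ : P₁.Monic)
    (hP₂ : P₂.Monic)
    (h0 : ∀ c : ℂ, (atZero P₁).IsRoot c → (atZero P₂).IsRoot c → c = 0)
    (hedges : EdgesInGeneralPosition (newtonPolygon P₁) (newtonPolygon P₂) P₁ P₂) :
    InitialFormsCoprime (P₁.map convergentSeries.subtype) (P₂.map convergentSeries.subtype) := by
  intro q p hp c hc₁ hc₂
  rcases q.eq_zero_or_pos with rfl | hq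
  · rw [initialPoly_zero_left (hP₁.map _) hp, Polynomial.map_map] at hc₁
    rw [initialPoly_zero_left (hP₂.map _) hp, Polynomial.map_map] at hc₂
    exact h0 c hc₁ hc₂
  by_contra hc
  have nonempty₁ : (exponents (P₁.map convergentSeries.subtype)).Nonempty :=
    ⟨_, natDegree_mem_exponents (hP₁.map _)⟩
  have nonempty₂ : (exponents (P₂.map convergentSeries.subtype)).Nonempty :=
    ⟨_, natDegree_mem_exponents (hP₂.map _)⟩
  have general_position := (edgesInGeneralPosition_iff
    ⟨_, nonempty₁, newtonPolygon_eq_hullOf_exponents P₁⟩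
    ⟨_, nonempty₂, newtonPolygon_eq_hullOf_exponents P₂⟩ rfl rfl).1 hedges
  refine general_position (q / p) (div_pos (Nat.cast_pos.2 hq) (Nat.cast_pos.2 hp))
    (nontrivial_slopeFace_of_isRoot_initialPoly nonempty₁ hq hp hc hc₁)
    (nontrivial_slopeFace_of_isRoot_initialPoly nonempty₂ hq hp hc hc₂) c hc ⟨?_, ?_⟩
  · rw [← eval_initialPoly_eq_evalEval_edgePolynomial P₁ hq hp, hc₁]
  · rw [← eval_initialPoly_eq_evalEval_edgePolynomial P₂ hq hp, hc₂]

theorem coeff_zero_ne_zero_of_hasFiniteArea {k : Type*} [Semiring k] {P : (PowerSeries k)[X]}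
    (h : HasFiniteArea (hullOf (exponents P))) : P.coeff 0 ≠ 0 := by
  obtain ⟨i, hi⟩ := exists_zero_fst_mem h
  intro h0
  exact hi (by rw [h0, map_zero])

theorem newtonPolygon_resultantPoly {P₁ P₂ : Cz[X]} (hP₁ : P₁.Monic) (hP₂ : P₂.Monic)
    (hA₁ : HasFiniteArea (newtonPolygon P₁)) (hA₂ : HasFiniteArea (newtonPolygon P₂))
    (h0 : ∀ c : ℂ, (atZero P₁).IsRoot c → (atZero P₂).IsRoot c → c = 0)
    (hedges : EdgesInGeneralPosition (newtonPolygon P₁) (newtonPolygon P₂) P₁ P₂) :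
    newtonPolygon (resultantPoly P₁ P₂) = polygonMul (newtonPolygon P₁) (newtonPolygon P₂) := by
  have coprime := initialFormsCoprime_of_edgesInGeneralPosition hP₁ hP₂ h0 hedges
  rw [newtonPolygon_eq_hullOf_exponents] at hA₁ hA₂
  rw [newtonPolygon_eq_hullOf_exponents, newtonPolygon_eq_hullOf_exponents,
    newtonPolygon_eq_hullOf_exponents, map_resultantPoly _ hP₁ hP₂]
  exact hullOf_exponents_resultantPoly (hP₁.map _) (hP₂.map _)
    (coeff_zero_ne_zero_of_hasFiniteArea hA₁) (coeff_zero_ne_zero_of_hasFiniteArea hA₂) coprime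

end NewtonProduct

theorem mainTheorem9_general (N₁ N₂ : Set (ℝ × ℝ))
    (hN₁ : NewtonProduct.IsNewtonPolygon N₁) (hN₂ : NewtonProduct.IsNewtonPolygon N₂) :
    (NewtonProduct.HasFiniteArea N₁ → NewtonProduct.HasFiniteArea N₂ →
      ∀ P₁ P₂ : NewtonProduct.Cz[X], P₁.Monic → P₂.Monic →
      NewtonProduct.newtonPolygon P₁ = N₁ → NewtonProduct.newtonPolygon P₂ = N₂ →
      (∀ c : ℂ, (NewtonProduct.atZero P₁).IsRoot c → (NewtonProduct.atZero P₂).IsRoot c → c = 0) →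
      NewtonProduct.EdgesInGeneralPosition N₁ N₂ P₁ P₂ →
      NewtonProduct.newtonPolygon (NewtonProduct.resultantPoly P₁ P₂) =
        NewtonProduct.polygonMul N₁ N₂) ∧
    (∃ F : MvPolynomial (NewtonProduct.EdgePoint N₁ ⊕ NewtonProduct.EdgePoint N₂) ℂ, F ≠ 0 ∧
      ∀ P₁ P₂ : NewtonProduct.Cz[X],
        NewtonProduct.newtonPolygon P₁ = N₁ → NewtonProduct.newtonPolygon P₂ = N₂ →
        (NewtonProduct.EdgesInGeneralPosition N₁ N₂ P₁ P₂ ↔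
          MvPolynomial.eval (NewtonProduct.edgeCoeffs N₁ N₂ P₁ P₂) F ≠ 0)) := by
  refine ⟨?_, NewtonProduct.exists_mvPolynomial_edgesInGeneralPosition_iff hN₁ hN₂⟩
  rintro hA₁ hA₂ P₁ P₂ hP₁ hP₂ rfl rfl h0 hedges
  exact NewtonProduct.newtonPolygon_resultantPoly hP₁ hP₂ hA₁ hA₂ h0 hedges

theorem mainTheorem9 (N₁ N₂ : Set (ℝ × ℝ))
    (hN₁ : NewtonProduct.IsNewtonPolygon N₁) (hN₂ : NewtonProduct.IsNewtonPolygon N₂)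
    (hA₁ : NewtonProduct.HasFiniteArea N₁) (hA₂ : NewtonProduct.HasFiniteArea N₂) :
    (∀ P₁ P₂ : NewtonProduct.Cz[X], P₁.Monic → P₂.Monic →
      NewtonProduct.newtonPolygon P₁ = N₁ → NewtonProduct.newtonPolygon P₂ = N₂ →
      (∀ c : ℂ, (NewtonProduct.atZero P₁).IsRoot c → (NewtonProduct.atZero P₂).IsRoot c → c = 0) →
      NewtonProduct.EdgesInGeneralPosition N₁ N₂ P₁ P₂ →
      NewtonProduct.newtonPolygon (NewtonProduct.resultantPoly P₁ P₂) =
        NewtonProduct.polygonMul N₁ N₂) ∧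
    (∃ F : MvPolynomial (NewtonProduct.EdgePoint N₁ ⊕ NewtonProduct.EdgePoint N₂) ℂ, F ≠ 0 ∧
      ∀ P₁ P₂ : NewtonProduct.Cz[X],
        NewtonProduct.newtonPolygon P₁ = N₁ → NewtonProduct.newtonPolygon P₂ = N₂ →
        (NewtonProduct.EdgesInGeneralPosition N₁ N₂ P₁ P₂ ↔
          MvPolynomial.eval (NewtonProduct.edgeCoeffs N₁ N₂ P₁ P₂) F ≠ 0)) := by
  have h := mainTheorem9_general N₁ N₂ hN₁ hN₂
  exact ⟨h.1 hA₁ hA₂, h.2⟩
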